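/- Let $(\mathcal A,\otimes,k)$ be a bicomplete abelian category with a closed symmetric monoidal structure, and let $\mathcal P$ be a reduced symmetric operad in $\mathcal A$ ($\mathcal P_0=0$, $\mathcal P_1=k$). Let $V=(V_1\xrightarrow{d}V_0)$ be a chain complex in $\mathcal A$ concentrated in degrees $1$ and $0$. Let $End^{\mathcal A}(V)_n$ be the object of $\mathcal A$ of chain maps $V^{\otimes n}\to V$ (the $0$-cycles of the internal Hom complex) and $End(X)_n=\underline{Hom}(X^{\otimes n},X)$ for $X\in\mathcal A$. Let $\partial:(V_1\oplus V_0)^{\otimes n}\to (V^{\otimes n})_1\oplus (V^{\otimes n})_0$ be the map which, on each summand of $(V_1\oplus V_0)^{\otimes n}$ given by a word in $V_1,V_0$, applies $d$ to all factors $V_1$ except the leftmost one and the identity to the other factors (so it is the identity on words with at most one letter $V_1$), and let $\rtimes: End^{\mathcal A}(V)_n\to End(V_1\oplus V_0)_n$ be $f\mapsto (f_1\oplus f_0)\circ\partial$. Let a $\mathcal P$-algebra structure on $V$ be given, i.e. chain maps $\mathcal P_n\otimes V^{\otimes n}\to V$ compatible with units, compositions and symmetric groups, with adjoints $\mathcal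 P_n\to End^{\mathcal A}(V)_n$. Then: (1) The composites $\mathcal P_n\to End^{\mathcal A}(V)_n\xrightarrow{\rtimes}End(V_1\oplus V_0)_n$ define a $\mathcal P$-algebra structure $\mu$ on $V_1\oplus V_0$, the degree $0$ part of the given structure is a $\mathcal P$-algebra structure on $V_0$, and $s=0\oplus \mathrm{Id}$, $t=d\oplus\mathrm{Id}:V_1\oplus V_0\rightrightarrows V_0$ and the inclusion $i_2:V_0\to V_1\oplus V_0$ are morphisms of $\mathcal P$-algebras with $s i_2=t i_2=\mathrm{Id}$. This reflexive graph is a $\mathrm{Cat}^1$-$\mathcal P$-algebra: with $E=V_1\oplus V_0$, for every $n\ge 2$ the composite $\mathcal P_n\otimes\ker s\otimes\ker t\otimes E^{\otimes n-2}\to\mathcal P_n\otimes E^{\otimes n}\xrightarrow{\mu}E$ is zero. (2) $V_1=\ker s$ carries a $\mathcal P$-algebra structure for which the inclusion $V_1\to V_1\oplus V_0$ is a morphism of $\mathcal P$-algebras, and the operations of $V_1\oplus V_0$ with at least one argument in $V_1$ and the others in $V_0$ or $V_1$ define an internal action $$\rho:\bigoplus_n\mathcal P_n\otimes_{\Sigma_n}\big((V_0\oplus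 V_1)^{\otimes n}/V_0^{\otimes n}\big)\to V_1$$ of $V_0$ on $V_1$ (a map that restricts to the structure map of $V_1$ and is associative). With these structures $d:V_1\to V_0$ is a crossed module of $\mathcal P$-algebras: $d$ is a morphism of $\mathcal P$-algebras, it is equivariant for $\rho$ and the natural action of $V_0$ on itself, and it satisfies the Peiffer identities, i.e. for all $n\ge i\ge 2$ the map $\rho$ on $\mathcal P_n\otimes V_1^{\otimes i}\otimes V_0^{\otimes n-i}$ equals its composite with $\mathrm{Id}\otimes\mathrm{Id}\otimes d^{\otimes i-1}\otimes\mathrm{Id}$, that is $$\rho(\gamma;x_1,\dots,x_i,b_{i+1},\dots,b_n)=\rho(\gamma;x_1,dx_2,\dots,dx_i,b_{i+1},\dots,b_n)$$ in element notation. -/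

import Mathlib

open CategoryTheory MonoidalCategory Limits

universe v u

noncomputable section

namespace OpAlg

attribute [local instance] Abelian.hasFiniteBiproducts

section Tensor

variable {C : Type u} [Category.{v} C] [MonoidalCategory C]

/-- The tensor product `X 0 ⊗ X 1 ⊗ ⋯ ⊗ X (n - 1)` of a finite family, bracketed from the left. -/
@[reducible]
def tprod : {n : ℕ} → (Fin n → C) → C
  | 0, _ => 𝟙_ C
  | n + 1, X => tprod (fun i : Fin n => X i.castSucc) ⊗ X (Fin.last n)

/-- The tensor product of a finite family of morphisms. -/
def tmap : {n : ℕ} → {X Y : Fin n → C} → (∀ i, X i ⟶ Y i) → (tprod X ⟶ tprod Y)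
  | 0, _, _, _ => 𝟙 (𝟙_ C)
  | n + 1, _, _, f => tmap (fun i : Fin n => f i.castSucc) ⊗ₘ f (Fin.last n)

/-- The tensor power `X^{⊗ n}`. -/
abbrev tpow (X : C) (n : ℕ) : C := tprod (fun _ : Fin n => X)

/-- The tensor power `f^{⊗ n}` of a morphism. -/
abbrev tpowMap {X Y : C} (f : X ⟶ Y) (n : ℕ) : tpow X n ⟶ tpow Y n := tmap (fun _ => f)

/-- The associativity isomorphism `X^{⊗ (a + b)} ≅ X^{⊗ a} ⊗ X^{⊗ b}`. -/
def tsplit (X : C) (a : ℕ) : (b : ℕ) → (tpow X (a + b) ≅ tpow X a ⊗ tpow X b)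
  | 0 => (ρ_ (tpow X a)).symm
  | b + 1 => whiskerRightIso (tsplit X a b) X ≪≫ α_ (tpow X a) (tpow X b) X

theorem tensorHom_whiskerRight_comm {W X W' X' Y Z : C} {g : W ⟶ X} {g' : W' ⟶ X'}
    {r : X ⟶ X'} {l : W ⟶ W'} (h : g ≫ r = l ≫ g') (f : Y ⟶ Z) :
    (g ⊗ₘ f) ≫ (r ▷ Z) = (l ▷ Y) ≫ (g' ⊗ₘ f) := by
  rw [MonoidalCategory.tensorHom_def, MonoidalCategory.tensorHom_def, Category.assoc, whisker_exchange,
    ← comp_whiskerRight_assoc, h, comp_whiskerRight_assoc]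

end Tensor

section Permutations

variable {C : Type u} [Category.{v} C] [MonoidalCategory C] [SymmetricCategory C]

/-- The symmetry of `X^{⊗ (n + 1)}` that moves the last factor to place `i` and keeps the order of
the other factors. -/
def moveLast (X : C) : (n : ℕ) → Fin (n + 1) → (tpow X (n + 1) ⟶ tpow X (n + 1))
  | 0, _ => 𝟙 _
  | n + 1, i =>
    if h : i = Fin.last (n + 1) then 𝟙 _
    else (α_ (tpow X n) X X).hom ≫ (tpow X n ◁ (β_ X X).hom) ≫ (α_ (tpow X n) X X).inv ≫
      (moveLast X n (i.castPred h) ▷ X)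

/-- The bijection `Fin n ≃ Fin m` obtained from `e : Fin (n + 1) ≃ Fin (m + 1)` by deleting the
last element of the source and its image, and renumbering in order. -/
def dropLast {n m : ℕ} (e : Fin (n + 1) ≃ Fin (m + 1)) : Fin n ≃ Fin m :=
  (finSuccAboveEquiv (Fin.last n)).trans
    ((e.subtypeEquiv (p := fun x => x ≠ Fin.last n) (q := fun y => y ≠ e (Fin.last n))
        (fun _ => not_congr e.injective.eq_iff.symm)).trans
      (finSuccAboveEquiv (e (Fin.last n))).symm)

/-- The symmetry of tensor powers that moves the factor at place `j` to place `e j`. For `n = m`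
this is the left action of the symmetric group on `X^{⊗ n}`. -/
def tperm (X : C) : {n m : ℕ} → (Fin n ≃ Fin m) → (tpow X n ⟶ tpow X m)
  | 0, 0, _ => 𝟙 _
  | _ + 1, m + 1, e => (tperm X (dropLast e) ▷ X) ≫ moveLast X m (e (Fin.last _))
  | 0, _ + 1, e => (e.symm 0).elim0
  | _ + 1, 0, e => (e 0).elim0

theorem tpowMap_moveLast {X Y : C} (f : X ⟶ Y) : ∀ (n : ℕ) (i : Fin (n + 1)),
    tpowMap f (n + 1) ≫ moveLast Y n i = moveLast X n i ≫ tpowMap f (n + 1)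
  | 0, _ => by simp [moveLast]
  | n + 1, i => by
    by_cases h : i = Fin.last (n + 1)
    · simp [moveLast, h]
    · have ih := tpowMap_moveLast f n (i.castPred h)
      rw [moveLast, moveLast, dif_neg h, dif_neg h]
      simp only [tmap] at ih ⊢
      simp only [Category.assoc]
      rw [← tensorHom_whiskerRight_comm ih f, associator_naturality_assoc,
        ← associator_inv_naturality_assoc]
      congr 1
      simp only [← id_tensorHom, tensorHom_comp_tensorHom_assoc, Category.id_comp,
        Category.comp_id, BraidedCategory.braiding_naturality]

theorem tpowMap_tperm {X Y : C} (f : X ⟶ Y) : ∀ {n m : ℕ} (e : Fin n ≃ Fin m),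
    tpowMap f n ≫ tperm Y e = tperm X e ≫ tpowMap f m
  | 0, 0, _ => by simp [tperm]
  | n + 1, m + 1, e => by
    have ih := tpowMap_tperm f (dropLast e)
    have h := tpowMap_moveLast f m (e (Fin.last n))
    simp only [tperm, Category.assoc]
    rw [← h]
    simp only [tmap] at ih ⊢
    rw [← Category.assoc, ← Category.assoc]
    congr 1
    exact tensorHom_whiskerRight_comm ih f
  | 0, _ + 1, e => (e.symm 0).elim0
  | _ + 1, 0, e => (e 0).elim0

/-- The morphism that feeds the `m` consecutive factors after the first `p` ones to `g`:
`z ⊗ (x₁, …, x_{p+m+q}) ↦ (x₁, …, x_p, g (z; x_{p+1}, …, x_{p+m}), x_{p+m+1}, …)`. -/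
def insertOp {X Z : C} {m : ℕ} (g : Z ⊗ tpow X m ⟶ X) (p q : ℕ) :
    Z ⊗ tpow X (p + m + q) ⟶ tpow X (p + 1 + q) :=
  (Z ◁ ((tsplit X (p + m) q).hom ≫ ((tsplit X p m).hom ▷ tpow X q))) ≫
    (α_ Z (tpow X p ⊗ tpow X m) (tpow X q)).inv ≫
    (((α_ Z (tpow X p) (tpow X m)).inv ≫ ((β_ Z (tpow X p)).hom ▷ tpow X m) ≫
      (α_ (tpow X p) Z (tpow X m)).hom ≫ (tpow X p ◁ g)) ▷ tpow X q) ≫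
    (tsplit X (p + 1) q).inv

end Permutations

section Operads

/-- The bijection that numbers the `p + m + q` inputs of a partial composite: `p` inputs on the
left, then the `m` inputs of the inserted operation, then `q` inputs on the right. -/
def slotEquiv (p m q : ℕ) : (Fin p ⊕ Fin q) ⊕ Fin m ≃ Fin (p + m + q) :=
  (Equiv.sumAssoc (Fin p) (Fin q) (Fin m)).trans
    (((Equiv.refl (Fin p)).sumCongr (Equiv.sumComm (Fin q) (Fin m))).trans
      ((Equiv.sumAssoc (Fin p) (Fin m) (Fin q)).symm.trans
        ((finSumFinEquiv.sumCongr (Equiv.refl (Fin q))).trans finSumFinEquiv)))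

/-- The bijection between the inputs of two partial composites given by a bijection `r` of the
outer inputs and a bijection `t` of the inner ones. -/
def slotPerm {p m q p' m' q' : ℕ} (r : Fin p ⊕ Fin q ≃ Fin p' ⊕ Fin q') (t : Fin m ≃ Fin m') :
    Fin (p + m + q) ≃ Fin (p' + m' + q') :=
  (slotEquiv p m q).symm.trans ((r.sumCongr t).trans (slotEquiv p' m' q'))

/-- Symmetric operads in a symmetric monoidal category, presented by partial compositions.
`act e` for `e : Fin n ≃ Fin n` is the right action of the permutation `e` on `obj n`; allowing
`e : Fin n ≃ Fin m` (so `n = m`) only serves to identify `obj n` and `obj m` when `n = m`.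
`circ p m q` is the partial composition `∘_{p+1}` of operations of arities `p + 1 + q` and `m`. -/
structure Operad (C : Type u) [Category.{v} C] [MonoidalCategory C] [SymmetricCategory C] where
  obj : ℕ → C
  act : ∀ {n m : ℕ}, (Fin n ≃ Fin m) → (obj m ⟶ obj n)
  one : 𝟙_ C ⟶ obj 1
  circ : ∀ p m q : ℕ, obj (p + 1 + q) ⊗ obj m ⟶ obj (p + m + q)
  act_refl : ∀ n : ℕ, act (Equiv.refl (Fin n)) = 𝟙 (obj n)
  act_trans : ∀ {n m l : ℕ} (e : Fin n ≃ Fin m) (e' : Fin m ≃ Fin l),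
    act (e.trans e') = act e' ≫ act e
  one_circ : ∀ m : ℕ,
    (one ▷ obj m) ≫ circ 0 m 0 ≫ act (finCongr (by omega : m = 0 + m + 0)) = (λ_ (obj m)).hom
  circ_one : ∀ p q : ℕ, (obj (p + 1 + q) ◁ one) ≫ circ p 1 q = (ρ_ (obj (p + 1 + q))).hom
  /-- `(x ∘ y) ∘ z = x ∘ (y ∘ z)` when `z` is inserted into an input of `y` -/
  circ_assoc : ∀ p q r s m : ℕ,
    (circ p (r + 1 + s) q ▷ obj m) ≫
        (act (finCongr (by omega : (p + r) + 1 + (s + q) = p + (r + 1 + s) + q)) ▷ obj m) ≫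
        circ (p + r) m (s + q) =
      (α_ (obj (p + 1 + q)) (obj (r + 1 + s)) (obj m)).hom ≫ (obj (p + 1 + q) ◁ circ r m s) ≫
        circ p (r + m + s) q ≫
        act (finCongr (by omega : (p + r) + m + (s + q) = p + (r + m + s) + q))
  /-- insertions of `y` and `z` into two different inputs of `x` commute -/
  circ_comm : ∀ p q r m n : ℕ,
    (act (finCongr (by omega : p + 1 + (q + 1 + r) = (p + 1 + q) + 1 + r)) ▷ obj m ▷ obj n) ≫
        (circ p m (q + 1 + r) ▷ obj n) ≫
        (act (finCongr (by omega : (p + m + q) + 1 + r = p + m + (q + 1 + r))) ▷ obj n) ≫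
        circ (p + m + q) n r =
      (α_ (obj ((p + 1 + q) + 1 + r)) (obj m) (obj n)).hom ≫
        (obj ((p + 1 + q) + 1 + r) ◁ (β_ (obj m) (obj n)).hom) ≫
        (α_ (obj ((p + 1 + q) + 1 + r)) (obj n) (obj m)).inv ≫
        (circ (p + 1 + q) n r ▷ obj m) ≫
        (act (finCongr (by omega : p + 1 + (q + n + r) = (p + 1 + q) + n + r)) ▷ obj m) ≫
        circ p m (q + n + r) ≫
        act (finCongr (by omega : (p + m + q) + n + r = p + m + (q + n + r)))
  /-- partial compositions are equivariant -/
  circ_act : ∀ {p m q p' m' q' : ℕ} (r : Fin p ⊕ Fin q ≃ Fin p' ⊕ Fin q') (t : Fin m ≃ Fin m'),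
    (act (slotPerm r (Equiv.refl (Fin 1))) ⊗ₘ act t) ≫ circ p m q =
      circ p' m' q' ≫ act (slotPerm r t)

variable {C : Type u} [Category.{v} C] [MonoidalCategory C] [SymmetricCategory C]

/-- An operad is reduced if `P(0) = 0` and `P(1)` is the monoidal unit. -/
def Operad.IsReduced (P : Operad C) : Prop := IsZero (P.obj 0) ∧ IsIso P.one

/-- The structure maps `μ n` respect the unit of the operad. -/
def UnitLaw (P : Operad C) {X : C} (μ : ∀ n, P.obj n ⊗ tpow X n ⟶ X) : Prop :=
  (P.one ▷ tpow X 1) ≫ μ 1 = (λ_ (tpow X 1)).hom ≫ (λ_ X).hom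

/-- The structure maps `μ n` respect the partial compositions of the operad. -/
def CompLaw (P : Operad C) {X : C} (μ : ∀ n, P.obj n ⊗ tpow X n ⟶ X) : Prop :=
  ∀ p m q : ℕ, (P.circ p m q ▷ tpow X (p + m + q)) ≫ μ (p + m + q) =
    (α_ (P.obj (p + 1 + q)) (P.obj m) (tpow X (p + m + q))).hom ≫
      (P.obj (p + 1 + q) ◁ insertOp (μ m) p q) ≫ μ (p + 1 + q)

/-- A structure of algebra over the operad `P` on the object `X`. -/
structure Alg (P : Operad C) (X : C) where
  μ : ∀ n : ℕ, P.obj n ⊗ tpow X n ⟶ X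
  unit : UnitLaw P μ
  comp : CompLaw P μ
  equivariant : ∀ {n m : ℕ} (e : Fin n ≃ Fin m),
    (P.act e ▷ tpow X n) ≫ μ n = (P.obj m ◁ tperm X e) ≫ μ m

/-- Morphisms of algebras over an operad. -/
def IsAlgHom {P : Operad C} {X Y : C} (a : Alg P X) (b : Alg P Y) (f : X ⟶ Y) : Prop :=
  ∀ n, (P.obj n ◁ tpowMap f n) ≫ b.μ n = a.μ n ≫ f

/-- The morphism from `P(n)` to the object `End(X)(n) = Hom(X^{⊗ n}, X)` of the endomorphism
operad that is adjoint to the structure map of an algebra. -/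
def Alg.toEnd [MonoidalClosed C] {P : Operad C} {X : C} (a : Alg P X) (n : ℕ) :
    P.obj n ⟶ (ihom (tpow X n)).obj X :=
  MonoidalClosed.curry ((β_ (tpow X n) (P.obj n)).hom ≫ a.μ n)

end Operads

section Words

variable {A : Type u} [Category.{v} A] [Abelian A]

/-- The object in degree `k` of a two-term graded object: `X` in degree `1`, `B` in degree `0`. -/
def pick (X B : A) : Fin 2 → A
  | 0 => B
  | 1 => X

/-- The inclusion of the degree `k` part in the total object `X ⊕ B`. -/
def inc (X B : A) : (k : Fin 2) → (pick X B k ⟶ X ⊞ B)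
  | 0 => biprod.inr
  | 1 => biprod.inl

/-- The projection of the total object `X ⊕ B` on the degree `k` part. -/
def prj (X B : A) : (k : Fin 2) → (X ⊞ B ⟶ pick X B k)
  | 0 => biprod.snd
  | 1 => biprod.fst

/-- The identity if `k = l`, the morphism `d` if `k = 1` and `l = 0`, zero if `k = 0` and
`l = 1`. -/
def step {X B : A} (d : X ⟶ B) : (k l : Fin 2) → (pick X B k ⟶ pick X B l)
  | 0, 0 => 𝟙 B
  | 1, 1 => 𝟙 X
  | 1, 0 => d
  | 0, 1 => 0

variable [MonoidalCategory A]

/-- The tensor product of copies of `X` and `B`, with `X` at the places where `w` is `1`. -/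
abbrev word (X B : A) {n : ℕ} (w : Fin n → Fin 2) : A := tprod (fun j => pick X B (w j))

/-- The inclusion of a summand of `(X ⊕ B)^{⊗ n}`. -/
abbrev wordInc (X B : A) {n : ℕ} (w : Fin n → Fin 2) : word X B w ⟶ tpow (X ⊞ B) n :=
  tmap (fun j => inc X B (w j))

/-- The projection on a summand of `(X ⊕ B)^{⊗ n}`. -/
abbrev wordPrj (X B : A) {n : ℕ} (w : Fin n → Fin 2) : tpow (X ⊞ B) n ⟶ word X B w :=
  tmap (fun j => prj X B (w j))

/-- If `w' ≤ w`, the morphism that applies `d` at the places where `w` is `1` and `w'` is `0`,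
and the identity elsewhere (the zero morphism otherwise). -/
abbrev wordStep {X B : A} (d : X ⟶ B) {n : ℕ} (w w' : Fin n → Fin 2) : word X B w ⟶ word X B w' :=
  tmap (fun j => step d (w j) (w' j))

/-- The words of length `n` and degree `k`. -/
abbrev Words (n k : ℕ) : Type := {w : Fin n → Fin 2 // ∑ i, (w i : ℕ) = k}

end Words

section TwoTerm

variable {A : Type u} [Category.{v} A] [Abelian A] [MonoidalCategory A]

/-- The degree `k` part of the tensor power `V^{⊗ n}` of the two-term complex
`V = (V₁ ⟶ V₀)`. -/
def cpow (V₁ V₀ : A) (n k : ℕ) : A := ⨁ (fun w : Words n k => word V₁ V₀ w.1)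

/-- If `w'` is obtained from `w` by replacing the entry `1` at a place `i` by `0`, the sign
`(-1)^(w 0 + ⋯ + w (i - 1))` of the Leibniz rule. -/
def leibnizSign {n : ℕ} (w w' : Fin n → Fin 2) : ℤ :=
  ∏ i, ∏ j, if j < i ∧ w i ≠ w' i then (-1) ^ (w j : ℕ) else 1

/-- The differential `(V^{⊗ n})_{k+1} ⟶ (V^{⊗ n})_k`. -/
def cpowD {V₁ V₀ : A} (d : V₁ ⟶ V₀) (n k : ℕ) : cpow V₁ V₀ n (k + 1) ⟶ cpow V₁ V₀ n k :=
  biproduct.matrix (fun (w : Words n (k + 1)) (w' : Words n k) =>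
    leibnizSign w.1 w'.1 • wordStep d w.1 w'.1)

/-- The projection of `(V₁ ⊕ V₀)^{⊗ n}` on its summand `(V^{⊗ n})_k`. -/
def cpowPrj (V₁ V₀ : A) (n k : ℕ) : tpow (V₁ ⊞ V₀) n ⟶ cpow V₁ V₀ n k :=
  biproduct.lift (fun w : Words n k => wordPrj V₁ V₀ w.1)

/-- The Koszul sign of a permutation of homogeneous factors of degrees `w 0, …, w (n - 1)`. -/
def koszulSign {n m : ℕ} (e : Fin n ≃ Fin m) (w : Fin n → Fin 2) : ℤ :=
  ∏ i, ∏ j, if i < j ∧ e j < e i then (-1) ^ ((w i : ℕ) * (w j : ℕ)) else 1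

/-- The symmetry of tensor powers of complexes that moves the factor at place `j` to place
`e j`, in degree `k`. -/
def cpowPerm [SymmetricCategory A] (V₁ V₀ : A) {n m : ℕ} (e : Fin n ≃ Fin m) (k : ℕ) :
    cpow V₁ V₀ n k ⟶ cpow V₁ V₀ m k :=
  biproduct.matrix (fun (w : Words n k) (w' : Words m k) =>
    koszulSign e w.1 • (wordInc V₁ V₀ w.1 ≫ tperm (V₁ ⊞ V₀) e ≫ wordPrj V₁ V₀ w'.1))

/-- The morphism on total objects `P ⊗ (V₁ ⊕ V₀)^{⊗ n} ⟶ V₁ ⊕ V₀` of the degree zero morphism of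
graded objects `P ⊗ V^{⊗ n} ⟶ V` with components `f₁` and `f₀`; it vanishes on
`(V^{⊗ n})_k` for `k ≥ 2`. -/
def totalMap {V₁ V₀ Z : A} {n : ℕ} (f₁ : Z ⊗ cpow V₁ V₀ n 1 ⟶ V₁) (f₀ : Z ⊗ cpow V₁ V₀ n 0 ⟶ V₀) :
    Z ⊗ tpow (V₁ ⊞ V₀) n ⟶ V₁ ⊞ V₀ :=
  biprod.lift ((Z ◁ cpowPrj V₁ V₀ n 1) ≫ f₁) ((Z ◁ cpowPrj V₁ V₀ n 0) ≫ f₀)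

/-- A structure of algebra over the operad `P` (of `A`, placed in degree zero) on the chain complex
`V = (d : V₁ ⟶ V₀)` concentrated in degrees `1` and `0`: morphisms of complexes
`P(n) ⊗ V^{⊗ n} ⟶ V`, with components `μ₁ n`, `μ₀ n` in degrees `1` and `0` (`V` is zero in
the other degrees), compatible with units, compositions and symmetries. -/
structure ComplexAlg [SymmetricCategory A] (P : Operad A) {V₁ V₀ : A} (d : V₁ ⟶ V₀) where
  μ₁ : ∀ n : ℕ, P.obj n ⊗ cpow V₁ V₀ n 1 ⟶ V₁
  μ₀ : ∀ n : ℕ, P.obj n ⊗ cpow V₁ V₀ n 0 ⟶ V₀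
  chain₁ : ∀ n, (P.obj n ◁ cpowD d n 0) ≫ μ₀ n = μ₁ n ≫ d
  chain₂ : ∀ n, (P.obj n ◁ cpowD d n 1) ≫ μ₁ n = 0
  unit : UnitLaw P (fun n => totalMap (μ₁ n) (μ₀ n))
  comp : CompLaw P (fun n => totalMap (μ₁ n) (μ₀ n))
  equivariant₁ : ∀ {n m : ℕ} (e : Fin n ≃ Fin m),
    (P.act e ▷ cpow V₁ V₀ n 1) ≫ μ₁ n = (P.obj m ◁ cpowPerm V₁ V₀ e 1) ≫ μ₁ m
  equivariant₀ : ∀ {n m : ℕ} (e : Fin n ≃ Fin m),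
    (P.act e ▷ cpow V₁ V₀ n 0) ≫ μ₀ n = (P.obj m ◁ cpowPerm V₁ V₀ e 0) ≫ μ₀ m

/-- The degree zero part of `μ`: the structure maps `P(n) ⊗ V₀^{⊗ n} ⟶ V₀`. -/
def ComplexAlg.base [SymmetricCategory A] {P : Operad A} {V₁ V₀ : A} {d : V₁ ⟶ V₀}
    (S : ComplexAlg P d) (n : ℕ) : P.obj n ⊗ tpow V₀ n ⟶ V₀ :=
  (P.obj n ◁ biproduct.ι (fun w : Words n 0 => word V₁ V₀ w.1) ⟨fun _ => 0, by simp⟩) ≫ S.μ₀ n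

variable [MonoidalClosed A]

/-- The differential from degree `0` to degree `-1` of the complex of internal morphisms
`Hom(V^{⊗ n}, V)`: it sends `(f₀, f₁)` to `(d ∘ f₁ - f₀ ∘ d, - f₁ ∘ d)`. -/
def homD {V₁ V₀ : A} (d : V₁ ⟶ V₀) (n : ℕ) :
    ((ihom (cpow V₁ V₀ n 1)).obj V₁ ⊞ (ihom (cpow V₁ V₀ n 0)).obj V₀) ⟶
      ((ihom (cpow V₁ V₀ n 1)).obj V₀ ⊞ (ihom (cpow V₁ V₀ n 2)).obj V₁) :=
  biprod.lift
    (biprod.fst ≫ (ihom (cpow V₁ V₀ n 1)).map d -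
      biprod.snd ≫ (MonoidalClosed.pre (cpowD d n 0)).app V₀)
    (-(biprod.fst ≫ (MonoidalClosed.pre (cpowD d n 1)).app V₁))

/-- The object `End^A(V)(n)` of morphisms of complexes `V^{⊗ n} ⟶ V`, that is the `0`-cycles of
the complex of internal morphisms. -/
def EndA {V₁ V₀ : A} (d : V₁ ⟶ V₀) (n : ℕ) : A := kernel (homD d n)

/-- The morphism `(ev₁, ev₀)`. -/
def EndA.ev {V₁ V₀ : A} (d : V₁ ⟶ V₀) (n : ℕ) : EndA d n ⟶
    (ihom (cpow V₁ V₀ n 1)).obj V₁ ⊞ (ihom (cpow V₁ V₀ n 0)).obj V₀ :=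
  kernel.ι (homD d n)

/-- The morphism `P(n) ⟶ End^A(V)(n)` adjoint to the structure maps of a `P`-algebra structure on
the complex `V`. -/
def ComplexAlg.toEndA [SymmetricCategory A] {P : Operad A} {V₁ V₀ : A} {d : V₁ ⟶ V₀}
    (S : ComplexAlg P d) (n : ℕ) : P.obj n ⟶ EndA d n :=
  kernel.lift (homD d n)
    (biprod.lift (MonoidalClosed.curry ((β_ (cpow V₁ V₀ n 1) (P.obj n)).hom ≫ S.μ₁ n))
      (MonoidalClosed.curry ((β_ (cpow V₁ V₀ n 0) (P.obj n)).hom ≫ S.μ₀ n)))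
    (by
      have h1 := S.chain₁ n
      have h2 := S.chain₂ n
      apply biprod.hom_ext
      · simp only [homD, Category.assoc, biprod.lift_fst, Preadditive.comp_sub,
          biprod.lift_fst_assoc, biprod.lift_snd_assoc, zero_comp]
        rw [sub_eq_zero, ← MonoidalClosed.curry_natural_right, MonoidalClosed.curry_pre_app]
        congr 1
        rw [Category.assoc, ← h1]
        simp
      · simp only [homD, Category.assoc, biprod.lift_snd, Preadditive.comp_neg,
          biprod.lift_fst_assoc, zero_comp]
        rw [MonoidalClosed.curry_pre_app, BraidedCategory.braiding_naturality_left_assoc, h2,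
          comp_zero, neg_eq_zero]
        apply MonoidalClosed.uncurry_injective
        rw [MonoidalClosed.uncurry_curry, MonoidalClosed.uncurry_eq]
        exact (((tensorLeft (cpow V₁ V₀ n 2)).map_zero _ _ |> congrArg
          (fun f => f ≫ (ihom.ev (cpow V₁ V₀ n 2)).app V₁)).trans zero_comp).symm)

/-- The word that keeps only the leftmost `1` of `w`. -/
def lead {n : ℕ} (w : Fin n → Fin 2) : Fin n → Fin 2 :=
  fun j => if w j = 1 ∧ ∀ i < j, w i = 0 then 1 else 0

/-- The morphism `(V₁ ⊕ V₀)^{⊗ n} ⟶ (V^{⊗ n})_1 ⊕ (V^{⊗ n})_0` that applies `d`, on each summand,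
to all factors `V₁` except the leftmost one (and so is the identity on the summands with at most
one factor `V₁`). -/
def partialMap {V₁ V₀ : A} (d : V₁ ⟶ V₀) (n : ℕ) :
    tpow (V₁ ⊞ V₀) n ⟶ cpow V₁ V₀ n 1 ⊞ cpow V₁ V₀ n 0 :=
  biprod.lift
    (biproduct.lift (fun w' : Words n 1 =>
      ∑ w : Fin n → Fin 2, if lead w = w'.1 then wordPrj V₁ V₀ w ≫ wordStep d w w'.1 else 0))
    (biproduct.lift (fun w' : Words n 0 =>
      ∑ w : Fin n → Fin 2, if lead w = w'.1 then wordPrj V₁ V₀ w ≫ wordStep d w w'.1 else 0))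

/-- The morphism `Hom(X₁, Y₁) ⊕ Hom(X₀, Y₀) ⟶ Hom(X₁ ⊕ X₀, Y₁ ⊕ Y₀)` of diagonal matrices. -/
def diagHom (X₁ X₀ Y₁ Y₀ : A) :
    ((ihom X₁).obj Y₁ ⊞ (ihom X₀).obj Y₀) ⟶ (ihom (X₁ ⊞ X₀)).obj (Y₁ ⊞ Y₀) :=
  biprod.desc
    ((MonoidalClosed.pre (biprod.fst : X₁ ⊞ X₀ ⟶ X₁)).app Y₁ ≫ (ihom (X₁ ⊞ X₀)).map biprod.inl)
    ((MonoidalClosed.pre (biprod.snd : X₁ ⊞ X₀ ⟶ X₀)).app Y₀ ≫ (ihom (X₁ ⊞ X₀)).map biprod.inr)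

/-- The morphism `⋊ : End^A(V)(n) ⟶ End(V₁ ⊕ V₀)(n)`. -/
def rtimes {V₁ V₀ : A} (d : V₁ ⟶ V₀) (n : ℕ) :
    EndA d n ⟶ (ihom (tpow (V₁ ⊞ V₀) n)).obj (V₁ ⊞ V₀) :=
  EndA.ev d n ≫ diagHom _ _ _ _ ≫ (MonoidalClosed.pre (partialMap d n)).app (V₁ ⊞ V₀)

end TwoTerm

section Cat1

variable {A : Type u} [Category.{v} A] [Abelian A] [MonoidalCategory A] [SymmetricCategory A]

/-- A reflexive graph `s, t : E ⇉ B`, `i : B ⟶ E` of algebras over `P`. -/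
structure IsReflexiveGraph {P : Operad A} {E B : A} (a : Alg P E) (b : Alg P B)
    (s t : E ⟶ B) (i : B ⟶ E) : Prop where
  hom_s : IsAlgHom a b s
  hom_t : IsAlgHom a b t
  hom_i : IsAlgHom b a i
  i_s : i ≫ s = 𝟙 B
  i_t : i ≫ t = 𝟙 B

/-- The family `ker s, ker t, E, …, E`. -/
def kerFamily {E B : A} (s t : E ⟶ B) (n : ℕ) : Fin (n + 2) → A :=
  Fin.cases (kernel s) (Fin.cases (kernel t) (fun _ => E))

/-- The inclusions of the members of the family `ker s, ker t, E, …, E` in `E`. -/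
def kerInc {E B : A} (s t : E ⟶ B) (n : ℕ) : ∀ j : Fin (n + 2), kerFamily s t n j ⟶ E :=
  Fin.cases (kernel.ι s) (Fin.cases (kernel.ι t) (fun _ => 𝟙 E))

/-- A `Cat¹`-algebra over `P`: a reflexive graph of algebras such that all operations of arity at
least two vanish on `ker s ⊗ ker t ⊗ E ⊗ ⋯ ⊗ E`. -/
structure IsCat1 {P : Operad A} {E B : A} (a : Alg P E) (b : Alg P B)
    (s t : E ⟶ B) (i : B ⟶ E) : Prop extends IsReflexiveGraph a b s t i where
  cat1 : ∀ n : ℕ, (P.obj (n + 2) ◁ tmap (kerInc s t n)) ≫ a.μ (n + 2) = 0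

end Cat1

section Actions

variable {A : Type u} [Category.{v} A] [Abelian A] [MonoidalCategory A] [SymmetricCategory A]

/-- The quotient `(X ⊕ B)^{⊗ n} / B^{⊗ n}`. -/
def relPow (X B : A) (n : ℕ) : A := cokernel (tpowMap (biprod.inr : B ⟶ X ⊞ B) n)

/-- The action of the symmetric group on `(X ⊕ B)^{⊗ n} / B^{⊗ n}`. -/
def relPerm (X B : A) {n : ℕ} (e : Equiv.Perm (Fin n)) : relPow X B n ⟶ relPow X B n :=
  cokernel.map _ _ (tperm B e) (tperm (X ⊞ B) e) (tpowMap_tperm _ e)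

/-- The coinvariants `P(n) ⊗_{Σ_n} ((X ⊕ B)^{⊗ n} / B^{⊗ n})`. -/
def relCoinv (P : Operad A) (X B : A) (n : ℕ) : A :=
  cokernel (biproduct.desc (fun e : Equiv.Perm (Fin n) =>
    (P.act e ▷ relPow X B n) - (P.obj n ◁ relPerm X B e)))

/-- The object `P ∘ (B | X) = ⨁ₙ P(n) ⊗_{Σ_n} ((X ⊕ B)^{⊗ n} / B^{⊗ n})`. -/
def relSchur [HasColimits A] (P : Operad A) (X B : A) : A := ∐ (relCoinv P X B)

/-- The canonical morphism `P(n) ⊗ (X ⊕ B)^{⊗ n} ⟶ P ∘ (B | X)`. -/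
def relSchur.of [HasColimits A] (P : Operad A) (X B : A) (n : ℕ) :
    P.obj n ⊗ tpow (X ⊞ B) n ⟶ relSchur P X B :=
  (P.obj n ◁ cokernel.π (tpowMap (biprod.inr : B ⟶ X ⊞ B) n)) ≫ cokernel.π _ ≫
    Sigma.ι (relCoinv P X B) n

/-- The map `P(n) ⊗ (X ⊕ B)^{⊗ n} ⟶ X ⊕ B` with components `r` and the structure map of `B`
(precomposed with the projection on `B^{⊗ n}`). -/
def semidirectMap {P : Operad A} {X B : A} (b : Alg P B) (n : ℕ)
    (r : P.obj n ⊗ tpow (X ⊞ B) n ⟶ X) : P.obj n ⊗ tpow (X ⊞ B) n ⟶ X ⊞ B :=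
  biprod.lift r ((P.obj n ◁ tpowMap (biprod.snd : X ⊞ B ⟶ B) n) ≫ b.μ n)

/-- An internal action of the algebra `B` on the algebra `X`: a morphism `ρ : P ∘ (B | X) ⟶ X`
that restricts to the structure map of `X` and is associative. -/
structure Action [HasColimits A] {P : Operad A} {X B : A} (x : Alg P X) (b : Alg P B) where
  ρ : relSchur P X B ⟶ X
  restrict : ∀ n : ℕ,
    (P.obj n ◁ tpowMap (biprod.inl : X ⟶ X ⊞ B) n) ≫ relSchur.of P X B n ≫ ρ = x.μ n
  assoc : ∀ p m q : ℕ,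
    (P.circ p m q ▷ tpow (X ⊞ B) (p + m + q)) ≫ relSchur.of P X B (p + m + q) ≫ ρ =
      (α_ (P.obj (p + 1 + q)) (P.obj m) (tpow (X ⊞ B) (p + m + q))).hom ≫
        (P.obj (p + 1 + q) ◁ insertOp (semidirectMap b m (relSchur.of P X B m ≫ ρ)) p q) ≫
        relSchur.of P X B (p + 1 + q) ≫ ρ

variable [HasColimits A]

/-- The restriction of an action to `P(n) ⊗ X^{(w)}`, where `X^{(w)}` is the tensor product of
copies of `X` and `B` with `X` at the places where `w` is `1`. -/
def Action.on {P : Operad A} {X B : A} {x : Alg P X} {b : Alg P B} (r : Action x b) {n : ℕ}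
    (w : Fin n → Fin 2) : P.obj n ⊗ word X B w ⟶ X :=
  (P.obj n ◁ wordInc X B w) ≫ relSchur.of P X B n ≫ r.ρ

/-- The action `r` of `B` on `X` is the one induced by an algebra `E`, an inclusion
`i : X ⟶ E` and a section `j : B ⟶ E`: the operations of `E` applied to elements of `X` and `B`
with at least one element of `X`. -/
def Action.IsInducedBy {P : Operad A} {X B E : A} {x : Alg P X} {b : Alg P B} (r : Action x b)
    (a : Alg P E) (i : X ⟶ E) (j : B ⟶ E) : Prop :=
  ∀ (n : ℕ) (w : Fin n → Fin 2), (∃ k, w k = 1) →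
    r.on w ≫ i = (P.obj n ◁ (wordInc X B w ≫ tpowMap (biprod.desc i j) n)) ≫ a.μ n

/-- A precrossed module: `d : X ⟶ B` is a morphism of algebras that is equivariant for the given
action of `B` on `X` and the natural action of `B` on itself. -/
structure IsPrecrossedModule {P : Operad A} {X B : A} {x : Alg P X} {b : Alg P B}
    (r : Action x b) (d : X ⟶ B) : Prop where
  hom : IsAlgHom x b d
  equivariant : ∀ (n : ℕ) (w : Fin n → Fin 2), (∃ k, w k = 1) →
    r.on w ≫ d = (P.obj n ◁ (wordInc X B w ≫ tpowMap (biprod.desc d (𝟙 B)) n)) ≫ b.μ n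

/-- The word `1 ⋯ 1 0 ⋯ 0` with `i` entries `1`. -/
def initialWord (n i : ℕ) : Fin n → Fin 2 := fun j => if (j : ℕ) < i then 1 else 0

/-- A crossed module: a precrossed module that satisfies the Peiffer identities
`ρ(γ; x₁, …, xᵢ, b_{i+1}, …, bₙ) = ρ(γ; x₁, d x₂, …, d xᵢ, b_{i+1}, …, bₙ)` for
`2 ≤ i ≤ n`. -/
structure IsCrossedModule {P : Operad A} {X B : A} {x : Alg P X} {b : Alg P B}
    (r : Action x b) (d : X ⟶ B) : Prop extends IsPrecrossedModule r d where
  peiffer : ∀ n i : ℕ, 2 ≤ i → i ≤ n →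
    r.on (initialWord n i) =
      (P.obj n ◁ wordStep d (initialWord n i) (initialWord n 1)) ≫ r.on (initialWord n 1)

end Actions

end OpAlg

end

/-!
Let `p`, `e`, `t` be the endomorphisms `(x, b) ↦ (0, b)`, `(x, 0)`, `(0, d x + b)` of
`E = V₁ ⊕ V₀`. The morphism `∂` that applies `d` to all factors `V₁` but the leftmost one is the
`n`-th component of `D + p^{⊗ n}`, where `D` is the `(p, t)`-twisted derivation
`∑ k, p^{⊗ k} ⊗ e ⊗ t^{⊗ (n - k - 1)}`. The operations `μ` intertwine `p`, `e`, `t` with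
`p^{⊗ n}`, `D`, `t^{⊗ n}` followed by the structure map of the complex, so that `∂` commutes with
the insertion of operations, and the associativity of `μ` is that of the structure map.

The chain condition in degree `2` says that `x ⊗ d y` and `d x ⊗ y` have the same image, so any
factor `V₁` may be kept in place of the leftmost one, which gives the equivariance of `μ`.

On `ker s ⊗ ker t ⊗ E^{⊗ (n - 2)}` every term of `∂` contains `p` applied to `ker s` or `t` applied
to `ker t`, and hence vanishes. The Peiffer identities are a form of this vanishing: the factors
`x_j` and `d x_j` have the same image under `t`, and `x₁` lies in `ker s`.
-/

noncomputable section

namespace OpAlg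

attribute [local instance] Abelian.hasFiniteBiproducts

section Families

variable {C : Type u} [Category.{v} C] [MonoidalCategory C]

theorem tmap_comp : ∀ {n : ℕ} {X Y Z : Fin n → C} (f : ∀ i, X i ⟶ Y i) (g : ∀ i, Y i ⟶ Z i),
    tmap f ≫ tmap g = tmap (fun i => f i ≫ g i)
  | 0, _, _, _, _, _ => Category.id_comp _
  | n + 1, _, _, _, f, g => by
    simp only [tmap, tensorHom_comp_tensorHom, tmap_comp]

theorem tmap_id : ∀ {n : ℕ} (X : Fin n → C), tmap (fun i => 𝟙 (X i)) = 𝟙 (tprod X)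
  | 0, _ => rfl
  | n + 1, X => by
    simp only [tmap, tmap_id, id_tensorHom_id]

theorem tpowMap_comp {X Y Z : C} (f : X ⟶ Y) (g : Y ⟶ Z) (n : ℕ) :
    tpowMap f n ≫ tpowMap g n = tpowMap (f ≫ g) n :=
  tmap_comp _ _

theorem tpowMap_id (X : C) (n : ℕ) : tpowMap (𝟙 X) n = 𝟙 (tpow X n) :=
  tmap_id _

theorem tpowMap_one {X Y : C} (f : X ⟶ Y) : tpowMap f 1 = 𝟙_ C ◁ f :=
  id_tensorHom _ _

theorem tmap_update_castSucc {n : ℕ} {X Y : Fin (n + 1) → C} (f : ∀ i, X i ⟶ Y i) (i : Fin n)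
    (g : X i.castSucc ⟶ Y i.castSucc) :
    tmap (Function.update f i.castSucc g) =
      tmap (Function.update (fun j : Fin n => f j.castSucc) i g) ⊗ₘ f (Fin.last n) := by
  have hlast : Function.update f i.castSucc g (Fin.last n) = f (Fin.last n) :=
    Function.update_of_ne (Fin.castSucc_lt_last i).ne' _ _
  have hinit : (fun j : Fin n => Function.update f i.castSucc g j.castSucc) =
      Function.update (fun j : Fin n => f j.castSucc) i g :=
    Fin.init_update_castSucc f i g
  rw [tmap, hlast, hinit]

theorem tmap_update_last {n : ℕ} {X Y : Fin (n + 1) → C} (f : ∀ i, X i ⟶ Y i)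
    (g : X (Fin.last n) ⟶ Y (Fin.last n)) :
    tmap (Function.update f (Fin.last n) g) = tmap (fun j : Fin n => f j.castSucc) ⊗ₘ g := by
  have hinit : (fun j : Fin n => Function.update f (Fin.last n) g j.castSucc) =
      fun j : Fin n => f j.castSucc :=
    Fin.init_update_last f g
  rw [tmap, Function.update_self, hinit]

theorem tmap_tsplit {X Y : C} (a : ℕ) : ∀ (b : ℕ) (f : Fin (a + b) → (X ⟶ Y)),
    tmap f ≫ (tsplit Y a b).hom =
      (tsplit X a b).hom ≫ (tmap (fun i => f (Fin.castAdd b i)) ⊗ₘ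
        tmap (fun i => f (Fin.natAdd a i)))
  | 0, f => by
    simp only [tsplit, Iso.symm_hom, tmap, tensorHom_id]
    exact rightUnitor_inv_naturality _
  | b + 1, f => by
    have ih := tensorHom_whiskerRight_comm (tmap_tsplit a b fun i => f i.castSucc)
      (f (Fin.last (a + b)))
    calc (tmap (fun i : Fin (a + b) => f i.castSucc) ⊗ₘ f (Fin.last (a + b))) ≫
          ((tsplit Y a b).hom ▷ Y) ≫ (α_ _ _ _).hom
        = ((tsplit X a b).hom ▷ X) ≫
            ((tmap (fun i => f (Fin.castAdd b i).castSucc) ⊗ₘ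
              tmap (fun i => f (Fin.natAdd a i).castSucc)) ⊗ₘ f (Fin.last (a + b))) ≫
            (α_ _ _ _).hom := by rw [← Category.assoc, ih, Category.assoc]
      _ = ((tsplit X a b).hom ▷ X) ≫ (α_ _ _ _).hom ≫
            (tmap (fun i => f (Fin.castAdd b i).castSucc) ⊗ₘ
              tmap (fun i => f (Fin.natAdd a i).castSucc) ⊗ₘ f (Fin.last (a + b))) := by
          rw [associator_naturality]
      _ = _ := (Category.assoc _ _ _).symm

theorem tpowMap_tsplit {X Y : C} (f : X ⟶ Y) (a b : ℕ) :
    tpowMap f (a + b) ≫ (tsplit Y a b).hom =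
      (tsplit X a b).hom ≫ (tpowMap f a ⊗ₘ tpowMap f b) :=
  tmap_tsplit a b fun _ => f

end Families

section Blocks

variable {C : Type u} [Category.{v} C] [MonoidalCategory C] {X Y : C} {p m q : ℕ}

/-- The isomorphism that cuts a tensor power into three blocks, bracketed as in `insertOp`. -/
def tsplit₃ (X : C) (p m q : ℕ) : tpow X (p + m + q) ≅ (tpow X p ⊗ tpow X m) ⊗ tpow X q :=
  tsplit X (p + m) q ≪≫ whiskerRightIso (tsplit X p m) (tpow X q)

/-- The morphism of tensor powers that acts by `a`, `b` and `c` on three consecutive blocks of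
factors. -/
def blockMap (a : tpow X p ⟶ tpow Y p) (b : tpow X m ⟶ tpow Y m) (c : tpow X q ⟶ tpow Y q) :
    tpow X (p + m + q) ⟶ tpow Y (p + m + q) :=
  (tsplit₃ X p m q).hom ≫ ((a ⊗ₘ b) ⊗ₘ c) ≫ (tsplit₃ Y p m q).inv

/-- The variant of `blockMap` in which the middle block is a single factor, so that it needs no
unitor. -/
def slotMap (a : tpow X p ⟶ tpow Y p) (h : X ⟶ Y) (c : tpow X q ⟶ tpow Y q) :
    tpow X (p + 1 + q) ⟶ tpow Y (p + 1 + q) :=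
  (tsplit X (p + 1) q).hom ≫ ((a ⊗ₘ h) ⊗ₘ c) ≫ (tsplit Y (p + 1) q).inv

theorem tsplit_conj_tpowMap (f : X ⟶ Y) (p q : ℕ) :
    (tsplit X p q).hom ≫ (tpowMap f p ⊗ₘ tpowMap f q) ≫ (tsplit Y p q).inv =
      tpowMap f (p + q) := by
  rw [← Category.assoc, Iso.comp_inv_eq, tpowMap_tsplit]

theorem blockMap_eq (a : tpow X p ⟶ tpow Y p) (b : tpow X m ⟶ tpow Y m)
    (c : tpow X q ⟶ tpow Y q) :
    blockMap a b c = (tsplit X (p + m) q).hom ≫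
      (((tsplit X p m).hom ≫ (a ⊗ₘ b) ≫ (tsplit Y p m).inv) ⊗ₘ c) ≫
        (tsplit Y (p + m) q).inv := by
  simp only [blockMap, tsplit₃, Iso.trans_hom, Iso.trans_inv, whiskerRightIso_hom,
    whiskerRightIso_inv, Category.assoc, ← tensorHom_id, tensorHom_comp_tensorHom_assoc,
    Category.id_comp, Category.comp_id]

theorem blockMap_tpowMap (f : X ⟶ Y) :
    blockMap (tpowMap f p) (tpowMap f m) (tpowMap f q) = tpowMap f (p + m + q) := by
  rw [blockMap_eq, tsplit_conj_tpowMap, tsplit_conj_tpowMap]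

theorem slotMap_tpowMap (f : X ⟶ Y) :
    slotMap (tpowMap f p) f (tpowMap f q) = tpowMap f (p + 1 + q) :=
  tsplit_conj_tpowMap f (p + 1) q

end Blocks

section Permutations

variable {C : Type u} [Category.{v} C] [MonoidalCategory C] [SymmetricCategory C] {X Y : C}

theorem tmap_moveLast : ∀ (n : ℕ) (i : Fin (n + 1)) (g : Fin (n + 1) → (X ⟶ Y)),
    (tmap (fun j => g (i.succAbove j)) ⊗ₘ g i) ≫ moveLast Y n i = moveLast X n i ≫ tmap g
  | 0, i, g => by
    obtain rfl : i = Fin.last 0 := Fin.fin_one_eq_zero i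
    simp [moveLast, tmap]
  | n + 1, i, g => by
    cases i using Fin.lastCases with
    | last =>
      simp only [moveLast, dif_pos, Fin.succAbove_last, Category.comp_id, Category.id_comp]
      rfl
    | cast i =>
      have ih := tensorHom_whiskerRight_comm (tmap_moveLast n i fun j => g j.castSucc)
        (g (Fin.last (n + 1)))
      have hlast : i.castSucc.succAbove (Fin.last n) = Fin.last (n + 1) :=
        Fin.succAbove_ne_last_last (Fin.castSucc_lt_last i).ne
      simp only [moveLast, dif_neg (Fin.castSucc_lt_last i).ne, Fin.castPred_castSucc, tmap,
        Fin.castSucc_succAbove_castSucc, hlast, Category.assoc] at ih ⊢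
      rw [← ih, associator_naturality_assoc, ← associator_inv_naturality_assoc]
      congr 1
      simp only [← id_tensorHom, tensorHom_comp_tensorHom_assoc, Category.id_comp,
        Category.comp_id, BraidedCategory.braiding_naturality]

theorem succAbove_dropLast {n m : ℕ} (e : Fin (n + 1) ≃ Fin (m + 1)) (j : Fin n) :
    (e (Fin.last n)).succAbove (dropLast e j) = e j.castSucc := by
  change ((finSuccAboveEquiv (e (Fin.last n))) (dropLast e j) : Fin (m + 1)) = _
  simp [dropLast, finSuccAboveEquiv_apply (Fin.last n) j]

theorem tmap_tperm : ∀ {n m : ℕ} (e : Fin n ≃ Fin m) (g : Fin m → (X ⟶ Y)),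
    tmap (fun j => g (e j)) ≫ tperm Y e = tperm X e ≫ tmap g
  | 0, 0, _, _ => by simp [tperm, tmap]
  | n + 1, m + 1, e, g => by
    have ih := tensorHom_whiskerRight_comm
      (tmap_tperm (dropLast e) fun j => g ((e (Fin.last n)).succAbove j)) (g (e (Fin.last n)))
    simp only [succAbove_dropLast] at ih
    simp only [tperm, Category.assoc, ← tmap_moveLast]
    simp only [tmap, reassoc_of% ih]
  | 0, _ + 1, e, _ => (e.symm 0).elim0
  | _ + 1, 0, e, _ => (e 0).elim0

end Permutations

section Insertions

variable {C : Type u} [Category.{v} C] [MonoidalCategory C] [SymmetricCategory C] {X Y Z : C}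
  {m : ℕ} {g : Z ⊗ tpow X m ⟶ X} {g' : Z ⊗ tpow Y m ⟶ Y}

theorem insertOp_slotMap {b : tpow X m ⟶ tpow Y m} {h : X ⟶ Y} (hg : g ≫ h = (Z ◁ b) ≫ g')
    {p q : ℕ} (a : tpow X p ⟶ tpow Y p) (c : tpow X q ⟶ tpow Y q) :
    insertOp g p q ≫ slotMap a h c = (Z ◁ blockMap a b c) ≫ insertOp g' p q := by
  change ((Z ◁ (tsplit₃ X p m q).hom) ≫ _) ≫ _ = _ ≫ (Z ◁ (tsplit₃ Y p m q).hom) ≫ _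
  simp only [blockMap, slotMap, MonoidalCategory.whiskerLeft_comp, Category.assoc,
    Iso.inv_hom_id_assoc, whiskerLeft_inv_hom_assoc]
  congr 1
  rw [← id_tensorHom Z, associator_inv_naturality_assoc]
  congr 1
  simp only [← Category.assoc]
  congr 1
  simp only [← tensorHom_id, tensorHom_comp_tensorHom, Category.comp_id, Category.id_comp]
  congr 1
  simp only [Category.assoc]
  rw [associator_inv_naturality_assoc, ← id_tensorHom, tensorHom_comp_tensorHom, hg,
    tensorHom_comp_tensorHom_assoc, BraidedCategory.braiding_naturality, Category.comp_id,
    Category.id_comp, ← Category.id_comp b, ← tensorHom_comp_tensorHom_assoc, Category.id_comp,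
    associator_naturality_assoc, ← id_tensorHom, ← id_tensorHom, tensorHom_comp_tensorHom,
    Category.comp_id]

theorem insertOp_tpowMap {f : X ⟶ Y} (hg : g ≫ f = (Z ◁ tpowMap f m) ≫ g') (p q : ℕ) :
    insertOp g p q ≫ tpowMap f (p + 1 + q) =
      (Z ◁ tpowMap f (p + m + q)) ≫ insertOp g' p q := by
  simpa only [slotMap_tpowMap, blockMap_tpowMap] using
    insertOp_slotMap hg (tpowMap f p) (tpowMap f q)

variable {P : Operad C} {μ : ∀ n, P.obj n ⊗ tpow X n ⟶ X} {ν : ∀ n, P.obj n ⊗ tpow Y n ⟶ Y}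
  {f : X ⟶ Y}

theorem UnitLaw.comp_hom (hν : UnitLaw P ν)
    (hf : ∀ n, (P.obj n ◁ tpowMap f n) ≫ ν n = μ n ≫ f) :
    (P.one ▷ tpow X 1) ≫ μ 1 ≫ f = (λ_ (tpow X 1)).hom ≫ (λ_ X).hom ≫ f := by
  rw [← hf, ← whisker_exchange_assoc, hν, tpowMap_one]
  simp

theorem CompLaw.comp_hom (hν : CompLaw P ν)
    (hf : ∀ n, (P.obj n ◁ tpowMap f n) ≫ ν n = μ n ≫ f) (p m q : ℕ) :
    (P.circ p m q ▷ tpow X (p + m + q)) ≫ μ (p + m + q) ≫ f =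
      (α_ (P.obj (p + 1 + q)) (P.obj m) (tpow X (p + m + q))).hom ≫
        (P.obj (p + 1 + q) ◁ insertOp (μ m) p q) ≫ μ (p + 1 + q) ≫ f := by
  rw [← hf, ← whisker_exchange_assoc, hν, ← hf, ← whiskerLeft_comp_assoc,
    insertOp_tpowMap (hf m).symm, MonoidalCategory.whiskerLeft_comp_assoc,
    associator_naturality_right_assoc]

/-- The structure of algebra on a subobject that is closed under the operations. -/
def Alg.restrict (a : Alg P Y) (f : X ⟶ Y) [Mono f] (μ : ∀ n, P.obj n ⊗ tpow X n ⟶ X)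
    (hf : ∀ n, (P.obj n ◁ tpowMap f n) ≫ a.μ n = μ n ≫ f) : Alg P X where
  μ := μ
  unit := by
    simpa only [UnitLaw, ← cancel_mono f, Category.assoc] using a.unit.comp_hom hf
  comp p m q := by
    simpa only [← cancel_mono f, Category.assoc] using a.comp.comp_hom hf p m q
  equivariant e := by
    rw [← cancel_mono f, Category.assoc, ← hf, ← whisker_exchange_assoc, a.equivariant,
      ← whiskerLeft_comp_assoc, tpowMap_tperm, MonoidalCategory.whiskerLeft_comp_assoc, hf,
      Category.assoc]

end Insertions

section Closed

theorem monoidalPreadditive_of_closed (C : Type u) [Category.{v} C] [Preadditive C]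
    [HasZeroObject C] [HasBinaryBiproducts C] [MonoidalCategory C] [SymmetricCategory C]
    [MonoidalClosed C] : MonoidalPreadditive C := by
  have tensorLeft_additive (X : C) : (tensorLeft X).Additive :=
    have := preservesBinaryBiproducts_of_preservesBinaryCoproducts (tensorLeft X)
    Functor.additive_of_preservesBinaryBiproducts _
  have whiskerLeft_zero (X Y Z : C) : X ◁ (0 : Y ⟶ Z) = 0 := (tensorLeft X).map_zero Y Z
  have whiskerLeft_add (X : C) {Y Z : C} (f g : Y ⟶ Z) : X ◁ (f + g) = X ◁ f + X ◁ g :=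
    (tensorLeft X).map_add
  have whiskerRight_eq (X : C) {Y Z : C} (f : Y ⟶ Z) :
      f ▷ X = (β_ Y X).hom ≫ (X ◁ f) ≫ (β_ X Z).hom := by simp
  exact
    { whiskerLeft_zero := whiskerLeft_zero _ _ _
      zero_whiskerRight := by
        intro X Y Z
        rw [whiskerRight_eq, whiskerLeft_zero, zero_comp, comp_zero]
      whiskerLeft_add := whiskerLeft_add _
      add_whiskerRight := by
        intro X Y Z f g
        rw [whiskerRight_eq, whiskerLeft_add, Preadditive.add_comp, Preadditive.comp_add,
          ← whiskerRight_eq, ← whiskerRight_eq] }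

theorem curry_add {C : Type u} [Category.{v} C] [Preadditive C] [MonoidalCategory C]
    [MonoidalPreadditive C] [MonoidalClosed C] {X Y Z : C} (f g : X ⊗ Y ⟶ Z) :
    MonoidalClosed.curry (f + g) = MonoidalClosed.curry f + MonoidalClosed.curry g :=
  (ihom.adjunction X).homAddEquiv_add Y Z f g

end Closed

section Multilinear

variable {C : Type u} [Category.{v} C] [Preadditive C] [MonoidalCategory C]
  [MonoidalPreadditive C]

theorem whiskerLeft_sub (Z : C) {X Y : C} (f g : X ⟶ Y) : Z ◁ (f - g) = Z ◁ f - Z ◁ g :=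
  (tensorLeft Z).map_sub

theorem tmap_update_add : ∀ {n : ℕ} {X Y : Fin n → C} (f : ∀ i, X i ⟶ Y i) (i : Fin n)
    (g h : X i ⟶ Y i), tmap (Function.update f i (g + h)) =
      tmap (Function.update f i g) + tmap (Function.update f i h)
  | 0, _, _, _, i, _, _ => i.elim0
  | n + 1, X, Y, f, i, g, h => by
    cases i using Fin.lastCases with
    | last => simp only [tmap_update_last, MonoidalPreadditive.tensor_add]
    | cast i => simp only [tmap_update_castSucc, tmap_update_add (fun j : Fin n => f j.castSucc) i,
        MonoidalPreadditive.add_tensor]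

/-- The tensor product of families of morphisms, as a multilinear map. -/
def tmapMultilinear {n : ℕ} (X Y : Fin n → C) :
    MultilinearMap ℤ (fun i => X i ⟶ Y i) (tprod X ⟶ tprod Y) :=
  MultilinearMap.mk' tmap tmap_update_add fun f i c g =>
    map_zsmul (AddMonoidHom.mk' (fun g => tmap (Function.update f i g)) (tmap_update_add f i)) c g

theorem tmap_eq_zero {n : ℕ} {X Y : Fin n → C} (f : ∀ i, X i ⟶ Y i) (i : Fin n) (h : f i = 0) :
    tmap f = 0 :=
  (tmapMultilinear X Y).map_coord_zero i h

theorem tmap_update_sub {n : ℕ} {X Y : Fin n → C} (f : ∀ i, X i ⟶ Y i) (i : Fin n)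
    (g h : X i ⟶ Y i) : tmap (Function.update f i (g - h)) =
      tmap (Function.update f i g) - tmap (Function.update f i h) :=
  (tmapMultilinear X Y).map_update_sub f i g h

theorem tpowMap_sum {X Y : C} {ι : Type*} [Fintype ι] (f : ι → (X ⟶ Y)) (n : ℕ) :
    tpowMap (∑ k, f k) n = ∑ w : Fin n → ι, tmap (fun j => f (w j)) := by
  classical
  exact (tmapMultilinear _ _).map_sum fun _ k => f k

end Multilinear

section TwistedDerivations

variable {C : Type u} [Category.{v} C] {X Y : C}

/-- The family `p, …, p, e, t, …, t` with `e` at place `k`. -/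
def derFamily (p e t : X ⟶ Y) {n : ℕ} (k j : Fin n) : X ⟶ Y :=
  if j < k then p else if j = k then e else t

variable {p e t : X ⟶ Y} {n : ℕ}

theorem derFamily_of_lt {k j : Fin n} (h : j < k) : derFamily p e t k j = p :=
  if_pos h

theorem derFamily_self (k : Fin n) : derFamily p e t k k = e := by
  simp [derFamily]

theorem derFamily_of_gt {k j : Fin n} (h : k < j) : derFamily p e t k j = t := by
  simp [derFamily, h.not_gt, h.ne']

variable [Preadditive C] [MonoidalCategory C]

/-- The sum of the morphisms `p^{⊗ k} ⊗ e ⊗ t^{⊗ (n - k - 1)}` of `n`-th tensor powers: the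
degree `n` component of the `(p, t)`-twisted derivation that extends `e`. -/
def twistedDer (p e t : X ⟶ Y) (n : ℕ) : tpow X n ⟶ tpow Y n :=
  ∑ k : Fin n, tmap (derFamily p e t k)

/-- The sum of `twistedDer p e t n` and `p^{⊗ n}`. -/
def twistedFold (p e t : X ⟶ Y) (n : ℕ) : tpow X n ⟶ tpow Y n :=
  twistedDer p e t n + tpowMap p n

variable [MonoidalPreadditive C] (p e t)

theorem twistedDer_tsplit (a b : ℕ) :
    twistedDer p e t (a + b) ≫ (tsplit Y a b).hom =
      (tsplit X a b).hom ≫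
        ((twistedDer p e t a ⊗ₘ tpowMap t b) + (tpowMap p a ⊗ₘ twistedDer p e t b)) := by
  have castAdd_lt_natAdd (k : Fin a) (j : Fin b) : Fin.castAdd b k < Fin.natAdd a j := by
    simp only [Fin.lt_def, Fin.val_castAdd, Fin.val_natAdd]; omega
  have derFamily_castAdd (k j : Fin a) :
      derFamily p e t (Fin.castAdd b k) (Fin.castAdd b j) = derFamily p e t k j := by
    simp [derFamily, (Fin.strictMono_castAdd b).lt_iff_lt]
  have derFamily_natAdd (k j : Fin b) :
      derFamily p e t (Fin.natAdd a k) (Fin.natAdd a j) = derFamily p e t k j := by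
    simp [derFamily]
  simp only [twistedDer, Fin.sum_univ_add, Preadditive.add_comp, Preadditive.sum_comp,
    tmap_tsplit, derFamily_castAdd, derFamily_natAdd, derFamily_of_lt (castAdd_lt_natAdd _ _),
    derFamily_of_gt (castAdd_lt_natAdd _ _), sum_tensor, tensor_sum, Preadditive.comp_add,
    Preadditive.comp_sum]

theorem tsplit_conj_twistedDer (a b : ℕ) :
    (tsplit X a b).hom ≫ ((twistedDer p e t a ⊗ₘ tpowMap t b) +
      (tpowMap p a ⊗ₘ twistedDer p e t b)) ≫ (tsplit Y a b).inv = twistedDer p e t (a + b) := by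
  rw [← Category.assoc, Iso.comp_inv_eq, twistedDer_tsplit]

theorem twistedDer_succ (n : ℕ) :
    twistedDer p e t (n + 1) = (twistedDer p e t n ⊗ₘ t) + (tpowMap p n ⊗ₘ e) := by
  have derFamily_castSucc (k j : Fin n) :
      derFamily p e t k.castSucc j.castSucc = derFamily p e t k j := by
    simp [derFamily]
  simp only [twistedDer, Fin.sum_univ_castSucc, tmap, derFamily_castSucc, derFamily_self,
    derFamily_of_lt (Fin.castSucc_lt_last _), derFamily_of_gt (Fin.castSucc_lt_last _),
    sum_tensor]

theorem twistedFold_blocks (a m b : ℕ) :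
    twistedFold p e t (a + m + b) =
      blockMap (twistedDer p e t a) (tpowMap t m) (tpowMap t b) +
        blockMap (tpowMap p a) (twistedDer p e t m) (tpowMap t b) +
          blockMap (tpowMap p a) (tpowMap p m) (twistedFold p e t b) := by
  rw [twistedFold, ← tsplit_conj_twistedDer, ← tsplit_conj_twistedDer p e t a m,
    ← tsplit_conj_tpowMap p (a + m) b, ← tsplit_conj_tpowMap p a m]
  simp only [blockMap_eq, twistedFold, MonoidalPreadditive.add_tensor,
    MonoidalPreadditive.tensor_add, Preadditive.add_comp, Preadditive.comp_add, add_assoc]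

theorem twistedFold_slots (a b : ℕ) :
    twistedFold p e t (a + 1 + b) =
      slotMap (twistedDer p e t a) t (tpowMap t b) + slotMap (tpowMap p a) e (tpowMap t b) +
        slotMap (tpowMap p a) p (twistedFold p e t b) := by
  rw [twistedFold, ← tsplit_conj_twistedDer, ← tsplit_conj_tpowMap p (a + 1) b, twistedDer_succ]
  simp only [slotMap, twistedFold, MonoidalPreadditive.add_tensor,
    MonoidalPreadditive.tensor_add, Preadditive.add_comp, Preadditive.comp_add, add_assoc]
  rfl

theorem insertOp_twistedFold [SymmetricCategory C] {p e t} {Z : C} {m : ℕ}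
    {g : Z ⊗ tpow X m ⟶ X} {g' : Z ⊗ tpow Y m ⟶ Y}
    (ht : g ≫ t = (Z ◁ tpowMap t m) ≫ g') (he : g ≫ e = (Z ◁ twistedDer p e t m) ≫ g')
    (hp : g ≫ p = (Z ◁ tpowMap p m) ≫ g') (a b : ℕ) :
    insertOp g a b ≫ twistedFold p e t (a + 1 + b) =
      (Z ◁ twistedFold p e t (a + m + b)) ≫ insertOp g' a b := by
  simp only [twistedFold_slots, twistedFold_blocks, Preadditive.comp_add,
    MonoidalPreadditive.whiskerLeft_add, Preadditive.add_comp, insertOp_slotMap ht,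
    insertOp_slotMap he, insertOp_slotMap hp]

end TwistedDerivations

section RelativePowers

variable {A : Type u} [Category.{v} A] [Abelian A] [MonoidalCategory A]

/-- The projection `(X ⊕ B)^{⊗ n} ⟶ (X ⊕ B)^{⊗ n} / B^{⊗ n}`. -/
def relProj (X B : A) (n : ℕ) : tpow (X ⊞ B) n ⟶ relPow X B n :=
  cokernel.π (tpowMap (biprod.inr : B ⟶ X ⊞ B) n)

instance (X B : A) (n : ℕ) : Epi (relProj X B n) :=
  inferInstanceAs (Epi (cokernel.π _))

theorem inr_relProj (X B : A) (n : ℕ) : tpowMap biprod.inr n ≫ relProj X B n = 0 :=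
  cokernel.condition _

theorem inr_snd_tpowMap (X B : A) (n : ℕ) :
    tpowMap (biprod.inr : B ⟶ X ⊞ B) n ≫ tpowMap biprod.snd n = 𝟙 _ := by
  rw [tpowMap_comp, biprod.inr_snd, tpowMap_id]

/-- The section of `relProj X B n` whose image is the kernel of the projection
`(X ⊕ B)^{⊗ n} ⟶ B^{⊗ n}`. -/
def relSec (X B : A) (n : ℕ) : relPow X B n ⟶ tpow (X ⊞ B) n :=
  cokernel.desc _ (𝟙 _ - tpowMap biprod.snd n ≫ tpowMap biprod.inr n) (by
    rw [Preadditive.comp_sub, reassoc_of% inr_snd_tpowMap X B n, Category.comp_id, sub_self])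

theorem relProj_relSec (X B : A) (n : ℕ) : relProj X B n ≫ relSec X B n =
    𝟙 _ - tpowMap biprod.snd n ≫ tpowMap biprod.inr n :=
  cokernel.π_desc _ _ _

theorem relSec_relProj (X B : A) (n : ℕ) : relSec X B n ≫ relProj X B n = 𝟙 (relPow X B n) := by
  rw [← cancel_epi (relProj X B n), ← Category.assoc, relProj_relSec, Preadditive.sub_comp,
    Category.assoc, inr_relProj, comp_zero, sub_zero, Category.id_comp, Category.comp_id]

/-- Tensoring on the left need not preserve epimorphisms, but `relProj X B n` is split. -/
instance (Z X B : A) (n : ℕ) : IsSplitEpi (Z ◁ relProj X B n) :=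
  ⟨⟨⟨Z ◁ relSec X B n, by
    rw [← MonoidalCategory.whiskerLeft_comp, relSec_relProj, MonoidalCategory.whiskerLeft_id]⟩⟩⟩

variable [SymmetricCategory A]

theorem relProj_relPerm (X B : A) {n : ℕ} (e : Equiv.Perm (Fin n)) :
    relProj X B n ≫ relPerm X B e = tperm (X ⊞ B) e ≫ relProj X B n :=
  cokernel.π_desc _ _ _

variable {P : Operad A} {X B Y : A}

/-- The projection of `P(n) ⊗ ((X ⊕ B)^{⊗ n} / B^{⊗ n})` on its coinvariants. -/
def relCoinv.proj (P : Operad A) (X B : A) (n : ℕ) :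
    P.obj n ⊗ relPow X B n ⟶ relCoinv P X B n :=
  cokernel.π _

/-- The morphism on coinvariants defined by an invariant morphism. -/
def relCoinv.desc {n : ℕ} (r : P.obj n ⊗ relPow X B n ⟶ Y)
    (he : ∀ e : Equiv.Perm (Fin n),
      (P.act e ▷ relPow X B n) ≫ r = (P.obj n ◁ relPerm X B e) ≫ r) :
    relCoinv P X B n ⟶ Y :=
  cokernel.desc _ r (by
    apply biproduct.hom_ext'
    intro e
    rw [biproduct.ι_desc_assoc, comp_zero, Preadditive.sub_comp, sub_eq_zero, he])

theorem relCoinv.proj_desc {n : ℕ} (r : P.obj n ⊗ relPow X B n ⟶ Y)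
    (he : ∀ e : Equiv.Perm (Fin n),
      (P.act e ▷ relPow X B n) ≫ r = (P.obj n ◁ relPerm X B e) ≫ r) :
    relCoinv.proj P X B n ≫ relCoinv.desc r he = r :=
  cokernel.π_desc _ _ _

variable [MonoidalPreadditive A] {r : ∀ n, P.obj n ⊗ tpow (X ⊞ B) n ⟶ Y}

theorem relProj_relSec_comp (h : ∀ n, (P.obj n ◁ tpowMap biprod.inr n) ≫ r n = 0) (n : ℕ) :
    (P.obj n ◁ relProj X B n) ≫ (P.obj n ◁ relSec X B n) ≫ r n = r n := by
  rw [← whiskerLeft_comp_assoc, relProj_relSec, whiskerLeft_sub, Preadditive.sub_comp,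
    MonoidalCategory.whiskerLeft_comp_assoc, h, comp_zero, sub_zero,
    MonoidalCategory.whiskerLeft_id, Category.id_comp]

theorem relSec_comp_invariant (h : ∀ n, (P.obj n ◁ tpowMap biprod.inr n) ≫ r n = 0)
    (he : ∀ (n : ℕ) (e : Equiv.Perm (Fin n)),
      (P.act e ▷ tpow (X ⊞ B) n) ≫ r n = (P.obj n ◁ tperm (X ⊞ B) e) ≫ r n)
    (n : ℕ) (e : Equiv.Perm (Fin n)) :
    (P.act e ▷ relPow X B n) ≫ (P.obj n ◁ relSec X B n) ≫ r n =
      (P.obj n ◁ relPerm X B e) ≫ (P.obj n ◁ relSec X B n) ≫ r n := by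
  rw [← cancel_epi (P.obj n ◁ relProj X B n), whisker_exchange_assoc, relProj_relSec_comp h,
    ← whiskerLeft_comp_assoc (P.obj n) (relProj X B n), relProj_relPerm,
    MonoidalCategory.whiskerLeft_comp_assoc, relProj_relSec_comp h, he]

variable [HasColimits A]

/-- The inclusion of the summand `P(n) ⊗_{Σ_n} ((X ⊕ B)^{⊗ n} / B^{⊗ n})`. -/
def relSchur.inj (P : Operad A) (X B : A) (n : ℕ) : relCoinv P X B n ⟶ relSchur P X B :=
  Limits.Sigma.ι (relCoinv P X B) n

/-- The morphism on `⨁ₙ P(n) ⊗_{Σ_n} ((X ⊕ B)^{⊗ n} / B^{⊗ n})` defined by equivariant morphisms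
on the `P(n) ⊗ (X ⊕ B)^{⊗ n}` that vanish on the `P(n) ⊗ B^{⊗ n}`. -/
def relSchur.desc (r : ∀ n, P.obj n ⊗ tpow (X ⊞ B) n ⟶ Y)
    (h : ∀ n, (P.obj n ◁ tpowMap biprod.inr n) ≫ r n = 0)
    (he : ∀ (n : ℕ) (e : Equiv.Perm (Fin n)),
      (P.act e ▷ tpow (X ⊞ B) n) ≫ r n = (P.obj n ◁ tperm (X ⊞ B) e) ≫ r n) :
    relSchur P X B ⟶ Y :=
  Limits.Sigma.desc fun n =>
    relCoinv.desc ((P.obj n ◁ relSec X B n) ≫ r n) (relSec_comp_invariant h he n)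

theorem relSchur.of_desc (h : ∀ n, (P.obj n ◁ tpowMap biprod.inr n) ≫ r n = 0)
    (he : ∀ (n : ℕ) (e : Equiv.Perm (Fin n)),
      (P.act e ▷ tpow (X ⊞ B) n) ≫ r n = (P.obj n ◁ tperm (X ⊞ B) e) ≫ r n) (n : ℕ) :
    relSchur.of P X B n ≫ relSchur.desc r h he = r n := by
  have inj_desc : relSchur.inj P X B n ≫ relSchur.desc r h he =
      relCoinv.desc _ (relSec_comp_invariant h he n) :=
    Limits.Sigma.ι_desc _ _
  have of_eq : relSchur.of P X B n =
      (P.obj n ◁ relProj X B n) ≫ relCoinv.proj P X B n ≫ relSchur.inj P X B n := rfl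
  rw [of_eq, Category.assoc, Category.assoc, inj_desc, relCoinv.proj_desc, relProj_relSec_comp h]

end RelativePowers

section Operads

variable {C : Type u} [Category.{v} C] [MonoidalCategory C] [SymmetricCategory C]

theorem Alg.μ_eq_permuted {P : Operad C} {E : C} (a : Alg P E) {n m : ℕ} (e : Fin n ≃ Fin m) :
    a.μ n = (P.act e.symm ▷ tpow E n) ≫ (P.obj m ◁ tperm E e) ≫ a.μ m := by
  rw [← a.equivariant, ← comp_whiskerRight_assoc, ← P.act_trans, Equiv.self_trans_symm,
    P.act_refl, id_whiskerRight, Category.id_comp]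

end Operads

section Cat1

variable {A : Type u} [Category.{v} A] [Abelian A] [MonoidalCategory A] [SymmetricCategory A]
  {P : Operad A} {E B : A} {a : Alg P E} {b : Alg P B} {s t : E ⟶ B} {i : B ⟶ E}

theorem exists_perm_zero_one {n : ℕ} {k l : Fin (n + 2)} (h : k ≠ l) :
    ∃ e : Equiv.Perm (Fin (n + 2)), e k = 0 ∧ e l = 1 := by
  have hl : Equiv.swap k 0 l ≠ 0 := fun h0 => h <| by
    rw [← (Equiv.swap k 0).injective.eq_iff, Equiv.swap_apply_left, h0]
  refine ⟨(Equiv.swap k 0).trans (Equiv.swap (Equiv.swap k 0 l) 1), ?_, ?_⟩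
  · simp [Equiv.swap_apply_of_ne_of_ne hl.symm]
  · simp

/-- The family `1 - i s, 1 - i t, 1, …, 1` of endomorphisms of `E`, which factors through
`kerInc s t n`. -/
def kerProj (s t : E ⟶ B) (i : B ⟶ E) (n : ℕ) : Fin (n + 2) → (E ⟶ E) :=
  Fin.cons (𝟙 E - s ≫ i) (Fin.cons (𝟙 E - t ≫ i) fun _ => 𝟙 E)

namespace IsCat1

theorem kerProj_μ (G : IsCat1 a b s t i) (n : ℕ) :
    (P.obj (n + 2) ◁ tmap (kerProj s t i n)) ≫ a.μ (n + 2) = 0 := by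
  let q : ∀ j : Fin (n + 2), E ⟶ kerFamily s t n j :=
    Fin.cases (kernel.lift s (𝟙 E - s ≫ i) (by simp [G.i_s]))
      (Fin.cases (kernel.lift t (𝟙 E - t ≫ i) (by simp [G.i_t])) fun _ => 𝟙 E)
  have hq : kerProj s t i n = fun j => q j ≫ kerInc s t n j := by
    funext j
    refine Fin.cases ?_ (fun j => Fin.cases ?_ (fun j => ?_) j) j
    · exact (kernel.lift_ι _ _ _).symm
    · exact (kernel.lift_ι _ _ _).symm
    · exact (Category.comp_id _).symm
  rw [hq, ← tmap_comp, MonoidalCategory.whiskerLeft_comp_assoc, G.cat1, comp_zero]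

theorem tmap_μ_eq_zero (G : IsCat1 a b s t i) {n : ℕ} {X : Fin n → A} (f : ∀ j, X j ⟶ E)
    {k l : Fin n} (hkl : k ≠ l) (hk : f k ≫ s = 0) (hl : f l ≫ t = 0) :
    (P.obj n ◁ tmap f) ≫ a.μ n = 0 := by
  obtain ⟨n, rfl⟩ : ∃ m, n = m + 2 := ⟨n - 2, by have := k.2; have := l.2; omega⟩
  obtain ⟨e, hek, hel⟩ := exists_perm_zero_one hkl
  rw [← Equiv.eq_symm_apply] at hek hel
  subst hek hel
  have hf : f = fun j => f j ≫ kerProj s t i n (e j) := by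
    funext j
    obtain ⟨j, rfl⟩ := e.symm.surjective j
    rw [Equiv.apply_symm_apply]
    refine Fin.cases ?_ (fun j => Fin.cases ?_ (fun j => ?_) j) j
    · simp [kerProj, reassoc_of% hk]
    · change f _ = f _ ≫ (𝟙 E - t ≫ i)
      simp [reassoc_of% hl]
    · simp [kerProj]
  rw [hf, ← tmap_comp, a.μ_eq_permuted e, whisker_exchange_assoc, ← whiskerLeft_comp_assoc,
    Category.assoc, tmap_tperm, MonoidalCategory.whiskerLeft_comp_assoc,
    MonoidalCategory.whiskerLeft_comp_assoc, G.kerProj_μ]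
  simp

theorem tmap_μ_congr [MonoidalPreadditive A] (G : IsCat1 a b s t i) {n : ℕ} {X : Fin n → A}
    (f g : ∀ j, X j ⟶ E) (k : Fin n) (hk : f k = g k) (hs : f k ≫ s = 0)
    (ht : ∀ j, f j ≫ t = g j ≫ t) :
    (P.obj n ◁ tmap f) ≫ a.μ n = (P.obj n ◁ tmap g) ≫ a.μ n := by
  have piecewise_k (S : Finset (Fin n)) : S.piecewise g f k = f k := by
    by_cases h : k ∈ S <;> simp [h, hk]
  have piecewise_μ (S : Finset (Fin n)) :
      (P.obj n ◁ tmap (S.piecewise g f)) ≫ a.μ n = (P.obj n ◁ tmap f) ≫ a.μ n := by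
    induction S using Finset.induction_on with
    | empty => simp
    | insert j S hj ih =>
      have hf : S.piecewise g f = Function.update (S.piecewise g f) j (f j) := by
        rw [← Finset.piecewise_eq_of_notMem S g f hj, Function.update_eq_self]
      rw [← ih, ← sub_eq_zero, ← Preadditive.sub_comp, ← whiskerLeft_sub,
        Finset.piecewise_insert]
      nth_rw 2 [hf]
      rw [← tmap_update_sub]
      rcases eq_or_ne j k with rfl | hjk
      · rw [tmap_eq_zero _ j (by simp [hk]), MonoidalPreadditive.whiskerLeft_zero, zero_comp]
      · refine G.tmap_μ_eq_zero _ hjk.symm ?_ ?_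
        · rw [Function.update_of_ne hjk.symm, piecewise_k, hs]
        · rw [Function.update_self, Preadditive.sub_comp, ht, sub_self]
  rw [← piecewise_μ Finset.univ, Finset.piecewise_univ]

end IsCat1

end Cat1

section Letters

variable {A : Type u} [Category.{v} A] [Abelian A] {X B : A}

theorem inc_snd_of_eq_one {k : Fin 2} (hk : k = 1) : inc X B k ≫ biprod.snd = 0 := by
  subst hk
  exact biprod.inl_snd

theorem step_self (d : X ⟶ B) : ∀ k : Fin 2, step d k k = 𝟙 _
  | 0 => rfl
  | 1 => rfl

theorem step_inc_of_eq (d : X ⟶ B) {k l : Fin 2} (h : k = l) :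
    step d k l ≫ inc X B l = inc X B k := by
  subst h
  rw [step_self, Category.id_comp]

theorem step_inc_target (d : X ⟶ B) : ∀ {k l : Fin 2}, l ≤ k →
    step d k l ≫ inc X B l ≫ biprod.desc d (𝟙 B) = inc X B k ≫ biprod.desc d (𝟙 B)
  | 0, 0, _ => Category.id_comp _
  | 1, 1, _ => Category.id_comp _
  | 1, 0, _ => by
    change d ≫ biprod.inr ≫ _ = biprod.inl ≫ _
    simp

variable [MonoidalCategory A] [MonoidalPreadditive A]

theorem eq_zero_of_isZero_left {Y Z W : A} (h : IsZero Y) (f : Y ⊗ Z ⟶ W) : f = 0 := by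
  rw [← Category.id_comp f, ← id_whiskerRight, h.eq_of_src (𝟙 Y) 0,
    MonoidalPreadditive.zero_whiskerRight, zero_comp]

theorem wordInc_snd {n : ℕ} {w : Fin n → Fin 2} (hw : ∃ k, w k = 1) :
    wordInc X B w ≫ tpowMap biprod.snd n = 0 := by
  obtain ⟨k, hk⟩ := hw
  rw [tmap_comp, tmap_eq_zero _ k (inc_snd_of_eq_one hk)]

end Letters

section SplitExtensions

variable {A : Type u} [Category.{v} A] [Abelian A] [MonoidalCategory A] [SymmetricCategory A]
  {P : Operad A} {X B : A} (a : Alg P (X ⊞ B)) {b : Alg P B}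

theorem semidirectMap_μ_fst (hs : IsAlgHom a b biprod.snd) (n : ℕ) :
    semidirectMap b n (a.μ n ≫ biprod.fst) = a.μ n := by
  rw [semidirectMap, hs]
  apply biprod.hom_ext <;> simp

theorem inr_μ_fst (hi : IsAlgHom b a biprod.inr) (n : ℕ) :
    (P.obj n ◁ tpowMap biprod.inr n) ≫ a.μ n ≫ biprod.fst = 0 := by
  rw [reassoc_of% hi n, biprod.inr_fst, comp_zero]

theorem μ_fst_equivariant (n : ℕ) (e : Equiv.Perm (Fin n)) :
    (P.act e ▷ tpow (X ⊞ B) n) ≫ a.μ n ≫ biprod.fst =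
      (P.obj n ◁ tperm (X ⊞ B) e) ≫ a.μ n ≫ biprod.fst := by
  rw [reassoc_of% a.equivariant e]

variable [MonoidalPreadditive A]

theorem inl_μ_fst_inl (hP : IsZero (P.obj 0)) (hs : IsAlgHom a b biprod.snd) (n : ℕ) :
    (P.obj n ◁ tpowMap biprod.inl n) ≫ a.μ n =
      ((P.obj n ◁ tpowMap biprod.inl n) ≫ a.μ n ≫ biprod.fst) ≫ biprod.inl := by
  cases n with
  | zero => simp only [eq_zero_of_isZero_left hP (a.μ 0), zero_comp, comp_zero]
  | succ n =>
    apply biprod.hom_ext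
    · simp
    · rw [Category.assoc, ← hs, ← whiskerLeft_comp_assoc, tmap_comp,
        tmap_eq_zero _ 0 biprod.inl_snd, MonoidalPreadditive.whiskerLeft_zero, zero_comp]
      simp

/-- The algebra structure on the kernel `X` of the morphism of algebras `X ⊕ B ⟶ B`. -/
def kernelAlg (hP : IsZero (P.obj 0)) (hs : IsAlgHom a b biprod.snd) : Alg P X :=
  a.restrict biprod.inl _ (inl_μ_fst_inl a hP hs)

theorem isAlgHom_inl (hP : IsZero (P.obj 0)) (hs : IsAlgHom a b biprod.snd) :
    IsAlgHom (kernelAlg a hP hs) a biprod.inl :=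
  inl_μ_fst_inl a hP hs

variable [HasColimits A]

/-- The action of `B` on the kernel `X` of the split extension of algebras `X ⊕ B ⟶ B`: the
`X`-component of the operations of `X ⊕ B`. -/
def kernelAction (hP : IsZero (P.obj 0)) (hs : IsAlgHom a b biprod.snd)
    (hi : IsAlgHom b a biprod.inr) : Action (kernelAlg a hP hs) b where
  ρ := relSchur.desc _ (inr_μ_fst a hi) (μ_fst_equivariant a)
  restrict n := by
    rw [relSchur.of_desc]
    rfl
  assoc p m q := by
    simp only [relSchur.of_desc, semidirectMap_μ_fst a hs]
    rw [reassoc_of% a.comp p m q]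

theorem kernelAction_on (hP : IsZero (P.obj 0)) (hs : IsAlgHom a b biprod.snd)
    (hi : IsAlgHom b a biprod.inr) {n : ℕ} {w : Fin n → Fin 2} (hw : ∃ k, w k = 1) :
    (kernelAction a hP hs hi).on w ≫ biprod.inl = (P.obj n ◁ wordInc X B w) ≫ a.μ n := by
  have on_eq : (kernelAction a hP hs hi).on w =
      (P.obj n ◁ wordInc X B w) ≫ a.μ n ≫ biprod.fst :=
    congrArg (_ ≫ ·) (relSchur.of_desc (inr_μ_fst a hi) (μ_fst_equivariant a) n)
  apply biprod.hom_ext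
  · simp [on_eq]
  · rw [Category.assoc _ (a.μ n), ← hs, ← whiskerLeft_comp_assoc, wordInc_snd hw]
    simp

theorem kernelAction_isInducedBy (hP : IsZero (P.obj 0)) (hs : IsAlgHom a b biprod.snd)
    (hi : IsAlgHom b a biprod.inr) :
    (kernelAction a hP hs hi).IsInducedBy a biprod.inl biprod.inr := by
  intro n w hw
  have desc_inl_inr : biprod.desc biprod.inl biprod.inr = 𝟙 (X ⊞ B) := by
    apply biprod.hom_ext' <;> simp
  rw [kernelAction_on a hP hs hi hw, desc_inl_inr, tpowMap_id, Category.comp_id]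

end SplitExtensions

section CrossedModules

variable {A : Type u} [Category.{v} A] [Abelian A] [MonoidalCategory A] [SymmetricCategory A]
  [MonoidalPreadditive A] [HasColimits A] {P : Operad A} {X B : A} {d : X ⟶ B}
  {a : Alg P (X ⊞ B)} {b : Alg P B}

theorem IsReflexiveGraph.isPrecrossedModule
    (G : IsReflexiveGraph a b biprod.snd (biprod.desc d (𝟙 B)) biprod.inr)
    (hP : IsZero (P.obj 0)) : IsPrecrossedModule (kernelAction a hP G.hom_s G.hom_i) d where
  hom n := by
    have hd : tpowMap d n = tpowMap (biprod.inl : X ⟶ X ⊞ B) n ≫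
        tpowMap (biprod.desc d (𝟙 B)) n := by
      rw [tpowMap_comp, biprod.inl_desc]
    rw [hd, MonoidalCategory.whiskerLeft_comp_assoc, G.hom_t,
      reassoc_of% isAlgHom_inl a hP G.hom_s n, biprod.inl_desc]
  equivariant n w hw := by
    rw [MonoidalCategory.whiskerLeft_comp_assoc, G.hom_t,
      ← reassoc_of% kernelAction_on a hP G.hom_s G.hom_i hw, biprod.inl_desc]

theorem IsCat1.isCrossedModule (G : IsCat1 a b biprod.snd (biprod.desc d (𝟙 B)) biprod.inr)
    (hP : IsZero (P.obj 0)) : IsCrossedModule (kernelAction a hP G.hom_s G.hom_i) d where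
  toIsPrecrossedModule := G.isPrecrossedModule hP
  peiffer n i hi hin := by
    let first : Fin n := ⟨0, by omega⟩
    have first_eq {l : ℕ} (hl : 1 ≤ l) : initialWord n l first = 1 := if_pos hl
    have le (j : Fin n) : initialWord n 1 j ≤ initialWord n i j := by
      simp only [initialWord]; split_ifs <;> omega
    rw [← cancel_mono biprod.inl, Category.assoc,
      kernelAction_on a hP G.hom_s G.hom_i ⟨first, first_eq (by omega)⟩,
      kernelAction_on a hP G.hom_s G.hom_i ⟨first, first_eq le_rfl⟩,
      ← whiskerLeft_comp_assoc, tmap_comp]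
    refine G.tmap_μ_congr _ _ first ?_ (inc_snd_of_eq_one (first_eq (by omega))) fun j => ?_
    · exact (step_inc_of_eq d ((first_eq (by omega)).trans (first_eq le_rfl).symm)).symm
    · rw [Category.assoc, step_inc_target d (le j)]

end CrossedModules

section Words

variable {A : Type u} [Category.{v} A] [Abelian A] {X B : A}

theorem inc_prj_self : ∀ k : Fin 2, inc X B k ≫ prj X B k = 𝟙 _
  | 0 => biprod.inr_snd
  | 1 => biprod.inl_fst

theorem inc_prj_of_ne : ∀ {k l : Fin 2}, k ≠ l → inc X B k ≫ prj X B l = 0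
  | 0, 0, h => absurd rfl h
  | 1, 1, h => absurd rfl h
  | 0, 1, _ => biprod.inr_fst
  | 1, 0, _ => biprod.inl_snd

theorem sum_prj_inc : ∑ k, prj X B k ≫ inc X B k = 𝟙 (X ⊞ B) := by
  rw [Fin.sum_univ_two, add_comm]
  exact biprod.total

theorem step_comp (d : X ⟶ B) : ∀ {k l m : Fin 2}, l ≤ k → m ≤ l →
    step d k l ≫ step d l m = step d k m
  | 0, 0, 0, _, _ => Category.id_comp _
  | 1, 0, 0, _, _ => Category.comp_id _
  | 1, 1, 0, _, _ => Category.id_comp _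
  | 1, 1, 1, _, _ => Category.id_comp _

variable [MonoidalCategory A]

theorem wordInc_wordPrj_self {n : ℕ} (w : Fin n → Fin 2) :
    wordInc X B w ≫ wordPrj X B w = 𝟙 _ := by
  simp only [tmap_comp, inc_prj_self, tmap_id]

theorem wordStep_self (d : X ⟶ B) {n : ℕ} (w : Fin n → Fin 2) : wordStep d w w = 𝟙 _ := by
  simp only [wordStep, step_self, tmap_id]

theorem wordStep_comp (d : X ⟶ B) {n : ℕ} {w w' w'' : Fin n → Fin 2} (h : w' ≤ w)
    (h' : w'' ≤ w') : wordStep d w w' ≫ wordStep d w' w'' = wordStep d w w'' := by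
  simp only [tmap_comp, step_comp d (h _) (h' _)]

theorem wordInc_tmap {d : X ⟶ B} {n : ℕ} {w w' : Fin n → Fin 2} {f : Fin n → (X ⊞ B ⟶ X ⊞ B)}
    (h : ∀ j, inc X B (w j) ≫ f j = step d (w j) (w' j) ≫ inc X B (w' j)) :
    wordInc X B w ≫ tmap f = wordStep d w w' ≫ wordInc X B w' := by
  simp only [tmap_comp, h]

variable [MonoidalPreadditive A]

theorem wordInc_tmap_eq_zero {n : ℕ} {w : Fin n → Fin 2} {Y : Fin n → A}
    {f : ∀ j, X ⊞ B ⟶ Y j} (k : Fin n) (h : inc X B (w k) ≫ f k = 0) :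
    wordInc X B w ≫ tmap f = 0 := by
  rw [tmap_comp, tmap_eq_zero _ k h]

theorem wordInc_wordPrj_of_ne {n : ℕ} {w w' : Fin n → Fin 2} (h : w ≠ w') :
    wordInc X B w ≫ wordPrj X B w' = 0 := by
  obtain ⟨k, hk⟩ := Function.ne_iff.1 h
  exact wordInc_tmap_eq_zero k (inc_prj_of_ne hk)

theorem wordStep_eq_zero (d : X ⟶ B) {n : ℕ} {w w' : Fin n → Fin 2} (k : Fin n) (h : w k = 0)
    (h' : w' k = 1) : wordStep d w w' = 0 := by
  refine tmap_eq_zero _ k ?_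
  rw [h, h']
  rfl

theorem sum_wordPrj_wordInc (n : ℕ) :
    ∑ w : Fin n → Fin 2, wordPrj X B w ≫ wordInc X B w = 𝟙 (tpow (X ⊞ B) n) := by
  simp only [tmap_comp, ← tpowMap_sum (fun k => prj X B k ≫ inc X B k), sum_prj_inc, tpowMap_id]

theorem word_hom_ext {n : ℕ} {Y : A} {f g : tpow (X ⊞ B) n ⟶ Y}
    (h : ∀ w, wordInc X B w ≫ f = wordInc X B w ≫ g) : f = g := by
  rw [← Category.id_comp f, ← Category.id_comp g, ← sum_wordPrj_wordInc]
  simp only [Preadditive.sum_comp, Category.assoc, h]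

theorem whiskerLeft_word_hom_ext {n : ℕ} {Y Z : A} {f g : Z ⊗ tpow (X ⊞ B) n ⟶ Y}
    (h : ∀ w, (Z ◁ wordInc X B w) ≫ f = (Z ◁ wordInc X B w) ≫ g) : f = g := by
  rw [← Category.id_comp f, ← Category.id_comp g, ← MonoidalCategory.whiskerLeft_id,
    ← sum_wordPrj_wordInc, whiskerLeft_sum]
  simp only [Preadditive.sum_comp, MonoidalCategory.whiskerLeft_comp, Category.assoc, h]

theorem wordInc_tperm_wordPrj_of_ne [SymmetricCategory A] {n m : ℕ} (e : Fin n ≃ Fin m)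
    {w : Fin n → Fin 2} {w' : Fin m → Fin 2} (h : w ≠ w' ∘ e) :
    wordInc X B w ≫ tperm (X ⊞ B) e ≫ wordPrj X B w' = 0 := by
  have tperm_wordPrj_wordInc : tperm (X ⊞ B) e ≫ wordPrj X B w' ≫ wordInc X B w' =
      wordPrj X B (w' ∘ e) ≫ wordInc X B (w' ∘ e) ≫ tperm (X ⊞ B) e := by
    rw [tmap_comp, ← Category.assoc, tmap_comp]
    exact (tmap_tperm e fun j => prj X B (w' j) ≫ inc X B (w' j)).symm
  rw [← Category.comp_id (wordPrj X B w'), ← wordInc_wordPrj_self,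
    reassoc_of% tperm_wordPrj_wordInc, reassoc_of% wordInc_wordPrj_of_ne h, zero_comp]

end Words

section Leading

variable {n : ℕ}

/-- The word with the single entry `1` at the place `k`. -/
abbrev single (k : Fin n) : Fin n → Fin 2 := Pi.single k 1

theorem single_le {w : Fin n → Fin 2} {k : Fin n} (hk : w k = 1) : single k ≤ w :=
  update_le_iff.2 ⟨hk.ge, fun _ _ => Fin.zero_le _⟩

theorem eq_zero_or_exists_leading (w : Fin n → Fin 2) :
    w = 0 ∨ ∃ k, w k = 1 ∧ ∀ i < k, w i = 0 := by
  refine or_iff_not_imp_left.2 fun hw => ?_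
  obtain ⟨k, hk, hmin⟩ := wellFounded_lt.has_min {k | w k ≠ 0} (Function.ne_iff.1 hw)
  exact ⟨k, Fin.eq_one_of_ne_zero _ hk, fun i hi => not_not.1 fun h => hmin i h hi⟩

theorem lead_zero : lead (0 : Fin n → Fin 2) = 0 := by
  funext j
  simp [lead]

theorem lead_eq_single {w : Fin n → Fin 2} {k : Fin n} (hk : w k = 1) (h : ∀ i < k, w i = 0) :
    lead w = single k := by
  funext j
  rcases lt_trichotomy j k with hj | rfl | hj
  · simp [lead, h j hj, hj.ne]
  · simpa [lead, hk] using h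
  · rw [lead, if_neg fun hl => by simp [hl.2 k hj] at hk]
    simp [hj.ne']

theorem lead_eq_self_of_subsingleton [Subsingleton (Fin n)] (w : Fin n → Fin 2) : lead w = w := by
  obtain rfl | ⟨k, hk, h⟩ := eq_zero_or_exists_leading w
  · exact lead_zero
  · rw [lead_eq_single hk h]
    funext j
    rw [Subsingleton.elim j k, hk]
    exact Pi.single_eq_same k _

theorem sum_single (k : Fin n) : ∑ i, (single k i : ℕ) = 1 := by
  rw [Fintype.sum_eq_single k fun j hj => by simp [hj]]
  simp

theorem eq_zero_of_sum_eq_zero {w : Fin n → Fin 2} (h : ∑ i, (w i : ℕ) = 0) : w = 0 := by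
  funext i
  exact Fin.ext (Finset.sum_eq_zero_iff.1 h i (Finset.mem_univ i))

theorem exists_eq_single {w : Fin n → Fin 2} (h : ∑ i, (w i : ℕ) = 1) : ∃ k, w = single k := by
  obtain rfl | ⟨k, hk, -⟩ := eq_zero_or_exists_leading w
  · simp at h
  refine ⟨k, (single_le hk).antisymm' fun j => ?_⟩
  by_cases hj : j = k
  · simp [hj, hk]
  · have sum_le := Finset.sum_le_univ_sum_of_nonneg (s := {j, k}) (f := fun i => (w i : ℕ))
      (fun _ => Nat.zero_le _)
    rw [Finset.sum_pair hj, h, hk, Fin.val_one] at sum_le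
    have val_eq_zero : (w j : ℕ) = 0 := by omega
    exact val_eq_zero.le.trans (Nat.zero_le _)

end Leading

section Folds

variable {A : Type u} [Category.{v} A] [Abelian A] {X B : A}

/-- The idempotent `(x, b) ↦ (x, 0)` of `X ⊕ B`. -/
abbrev topProj (X B : A) : X ⊞ B ⟶ X ⊞ B := biprod.fst ≫ biprod.inl

/-- The idempotent `(x, b) ↦ (0, b)` of `X ⊕ B`. -/
abbrev baseProj (X B : A) : X ⊞ B ⟶ X ⊞ B := biprod.snd ≫ biprod.inr

/-- The idempotent `(x, b) ↦ (0, d x + b)` of `X ⊕ B`. -/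
abbrev target (d : X ⟶ B) : X ⊞ B ⟶ X ⊞ B := biprod.desc d (𝟙 B) ≫ biprod.inr

theorem inc_topProj_of_eq_one {k : Fin 2} (hk : k = 1) : inc X B k ≫ topProj X B = inc X B k := by
  subst hk
  exact biprod.inl_fst_assoc _

theorem inc_topProj_of_eq_zero {k : Fin 2} (hk : k = 0) : inc X B k ≫ topProj X B = 0 := by
  subst hk
  exact (biprod.inr_fst_assoc _).trans zero_comp

theorem inc_baseProj_of_eq_one {k : Fin 2} (hk : k = 1) : inc X B k ≫ baseProj X B = 0 := by
  subst hk
  exact (biprod.inl_snd_assoc _).trans zero_comp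

theorem inc_baseProj_of_eq_zero {k : Fin 2} (hk : k = 0) :
    inc X B k ≫ baseProj X B = inc X B k := by
  subst hk
  exact biprod.inr_snd_assoc _

theorem inc_target (d : X ⟶ B) : ∀ {k l : Fin 2}, l = 0 →
    inc X B k ≫ target d = step d k l ≫ inc X B l
  | 0, _, rfl => biprod.inr_desc_assoc _ _ _
  | 1, _, rfl => biprod.inl_desc_assoc _ _ _

variable [MonoidalCategory A]

/-- The endomorphism of `(X ⊕ B)^{⊗ n}` that applies `d`, on each summand, to all factors `X`
except the leftmost one. -/
def fold (d : X ⟶ B) (n : ℕ) : tpow (X ⊞ B) n ⟶ tpow (X ⊞ B) n :=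
  twistedFold (baseProj X B) (topProj X B) (target d) n

theorem wordInc_tpowMap_target (d : X ⟶ B) {n : ℕ} (w : Fin n → Fin 2) :
    wordInc X B w ≫ tpowMap (target d) n = wordStep d w 0 ≫ wordInc X B 0 :=
  wordInc_tmap fun _ => inc_target d rfl

theorem wordInc_zero_tpowMap_baseProj (n : ℕ) :
    wordInc X B (0 : Fin n → Fin 2) ≫ tpowMap (baseProj X B) n = wordInc X B 0 := by
  rw [tmap_comp]
  exact congrArg tmap (funext fun _ => inc_baseProj_of_eq_zero rfl)

/-- The endomorphism of `(X ⊕ B)^{⊗ n}` that applies `(x, b) ↦ (x, 0)` to the factor `k` and `f` to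
the others. -/
abbrev topProjAt (f : X ⊞ B ⟶ X ⊞ B) {n : ℕ} (k : Fin n) : tpow (X ⊞ B) n ⟶ tpow (X ⊞ B) n :=
  tmap (Function.update (fun _ => f) k (topProj X B))

theorem topProjAt_tperm [SymmetricCategory A] (f : X ⊞ B ⟶ X ⊞ B) {n m : ℕ} (e : Fin n ≃ Fin m)
    (k : Fin m) :
    topProjAt f (e.symm k) ≫ tperm (X ⊞ B) e = tperm (X ⊞ B) e ≫ topProjAt f k := by
  rw [← tmap_tperm]
  exact congrArg (tmap · ≫ _) (Function.update_comp_equiv (fun _ => f) e k _).symm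

theorem wordInc_topProjAt_id {n : ℕ} {w : Fin n → Fin 2} {k : Fin n} (hk : w k = 1) :
    wordInc X B w ≫ topProjAt (𝟙 _) k = wordInc X B w := by
  rw [tmap_comp]
  refine congrArg tmap (funext fun j => ?_)
  obtain rfl | hj := eq_or_ne j k
  · rw [Function.update_self, inc_topProj_of_eq_one hk]
  · rw [Function.update_of_ne hj, Category.comp_id]

theorem wordInc_topProjAt_target (d : X ⟶ B) {n : ℕ} {w : Fin n → Fin 2} {k : Fin n}
    (hk : w k = 1) : wordInc X B w ≫ topProjAt (target d) k =
      wordStep d w (single k) ≫ wordInc X B (single k) := by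
  refine wordInc_tmap fun j => ?_
  obtain rfl | hj := eq_or_ne j k
  · rw [Function.update_self, inc_topProj_of_eq_one hk, step_inc_of_eq]
    simp [hk]
  · rw [Function.update_of_ne hj]
    exact inc_target d (Pi.single_eq_of_ne hj _)

variable [MonoidalPreadditive A]

theorem wordInc_tpowMap_baseProj_eq_zero {n : ℕ} {w : Fin n → Fin 2} {k : Fin n} (hk : w k = 1) :
    wordInc X B w ≫ tpowMap (baseProj X B) n = 0 :=
  wordInc_tmap_eq_zero k (inc_baseProj_of_eq_one hk)

theorem wordInc_zero_fold (d : X ⟶ B) (n : ℕ) :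
    wordInc X B (0 : Fin n → Fin 2) ≫ fold d n = wordInc X B 0 := by
  have zero_term (k : Fin n) : wordInc X B (0 : Fin n → Fin 2) ≫
      tmap (derFamily (baseProj X B) (topProj X B) (target d) k) = 0 :=
    wordInc_tmap_eq_zero k (by rw [derFamily_self]; exact inc_topProj_of_eq_zero rfl)
  rw [fold, twistedFold, twistedDer, Preadditive.comp_add, Preadditive.comp_sum,
    Finset.sum_eq_zero fun k _ => zero_term k, zero_add, wordInc_zero_tpowMap_baseProj]

theorem wordInc_fold_of_leading (d : X ⟶ B) {n : ℕ} {w : Fin n → Fin 2} {k : Fin n}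
    (hk : w k = 1) (h : ∀ i < k, w i = 0) :
    wordInc X B w ≫ fold d n = wordStep d w (single k) ≫ wordInc X B (single k) := by
  have zero_term (l : Fin n) (hl : l ≠ k) : wordInc X B w ≫
      tmap (derFamily (baseProj X B) (topProj X B) (target d) l) = 0 := by
    rcases hl.lt_or_gt with hl | hl
    · exact wordInc_tmap_eq_zero l (by rw [derFamily_self, inc_topProj_of_eq_zero (h l hl)])
    · exact wordInc_tmap_eq_zero k (by rw [derFamily_of_lt hl, inc_baseProj_of_eq_one hk])
  rw [fold, twistedFold, twistedDer, Preadditive.comp_add, Preadditive.comp_sum,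
    Fintype.sum_eq_single k zero_term, wordInc_tpowMap_baseProj_eq_zero hk, add_zero]
  refine wordInc_tmap fun j => ?_
  rcases lt_trichotomy j k with hj | rfl | hj
  · rw [derFamily_of_lt hj, inc_baseProj_of_eq_zero (h j hj), step_inc_of_eq]
    simp [h j hj, hj.ne]
  · rw [derFamily_self, inc_topProj_of_eq_one hk, step_inc_of_eq]
    simp [hk]
  · rw [derFamily_of_gt hj]
    exact inc_target d (Pi.single_eq_of_ne hj.ne' _)

theorem wordInc_fold (d : X ⟶ B) {n : ℕ} (w : Fin n → Fin 2) :
    wordInc X B w ≫ fold d n = wordStep d w (lead w) ≫ wordInc X B (lead w) := by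
  obtain rfl | ⟨k, hk, h⟩ := eq_zero_or_exists_leading w
  · rw [lead_zero, wordStep_self, Category.id_comp, wordInc_zero_fold]
  · rw [lead_eq_single hk h, wordInc_fold_of_leading d hk h]

theorem fold_one (d : X ⟶ B) : fold d 1 = 𝟙 _ := by
  refine word_hom_ext fun w => ?_
  rw [wordInc_fold, lead_eq_self_of_subsingleton, wordStep_self, Category.id_comp,
    Category.comp_id]

theorem fold_wordPrj (d : X ⟶ B) {n : ℕ} (w' : Fin n → Fin 2) :
    fold d n ≫ wordPrj X B w' =
      ∑ w : Fin n → Fin 2, if lead w = w' then wordPrj X B w ≫ wordStep d w w' else 0 := by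
  rw [← Category.id_comp (fold d n), ← sum_wordPrj_wordInc, Preadditive.sum_comp,
    Preadditive.sum_comp]
  refine Finset.sum_congr rfl fun w _ => ?_
  rw [Category.assoc, Category.assoc, reassoc_of% wordInc_fold d w]
  split_ifs with h
  · subst h
    rw [wordInc_wordPrj_self, Category.comp_id]
  · rw [wordInc_wordPrj_of_ne h, comp_zero, comp_zero]

theorem tmap_fold_eq_zero (d : X ⟶ B) {n : ℕ} {Y : Fin (n + 2) → A} (f : ∀ j, Y j ⟶ X ⊞ B)
    (h₀ : f 0 ≫ biprod.snd = 0) (h₁ : f 1 ≫ biprod.desc d (𝟙 B) = 0) :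
    tmap f ≫ fold d (n + 2) = 0 := by
  have base_zero : f 0 ≫ baseProj X B = 0 := by rw [reassoc_of% h₀, zero_comp]
  have term_zero (k : Fin (n + 2)) :
      tmap f ≫ tmap (derFamily (baseProj X B) (topProj X B) (target d) k) = 0 := by
    rw [tmap_comp]
    by_cases hk : k = 0
    · subst hk
      refine tmap_eq_zero _ 1 ?_
      rw [derFamily_of_gt Fin.zero_lt_one, reassoc_of% h₁, zero_comp]
    · refine tmap_eq_zero _ 0 ?_
      rw [derFamily_of_lt (Fin.pos_of_ne_zero hk), base_zero]
  rw [fold, twistedFold, twistedDer, Preadditive.comp_add, Preadditive.comp_sum,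
    Finset.sum_eq_zero fun k _ => term_zero k, zero_add, tmap_comp, tmap_eq_zero _ 0 base_zero]

theorem wordInc_topProjAt_eq_zero (f : X ⊞ B ⟶ X ⊞ B) {n : ℕ} {w : Fin n → Fin 2} {k : Fin n}
    (hk : w k = 0) : wordInc X B w ≫ topProjAt f k = 0 :=
  wordInc_tmap_eq_zero k (by rw [Function.update_self, inc_topProj_of_eq_zero hk])

theorem hom_ext_of_topProjAt {n : ℕ} {Y Z : A} {f g : Z ⊗ tpow (X ⊞ B) n ⟶ Y}
    (h : (Z ◁ tpowMap (baseProj X B) n) ≫ f = (Z ◁ tpowMap (baseProj X B) n) ≫ g)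
    (h' : ∀ k, (Z ◁ topProjAt (𝟙 _) k) ≫ f = (Z ◁ topProjAt (𝟙 _) k) ≫ g) : f = g := by
  refine whiskerLeft_word_hom_ext fun w => ?_
  obtain rfl | ⟨k, hk, -⟩ := eq_zero_or_exists_leading w
  · rw [← wordInc_zero_tpowMap_baseProj, MonoidalCategory.whiskerLeft_comp_assoc, h,
      MonoidalCategory.whiskerLeft_comp_assoc]
  · rw [← wordInc_topProjAt_id hk, MonoidalCategory.whiskerLeft_comp_assoc, h',
      MonoidalCategory.whiskerLeft_comp_assoc]

end Folds

section Signs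

theorem leibnizSign_eq_prod {n : ℕ} {w w' : Fin n → Fin 2} {k : Fin n} (hk : w k ≠ w' k)
    (h : ∀ i ≠ k, w i = w' i) :
    leibnizSign w w' = ∏ j, if j < k then (-1 : ℤ) ^ (w j : ℕ) else 1 := by
  rw [leibnizSign, Fintype.prod_eq_single k fun i hi => by simp [h i hi]]
  simp [hk]

theorem leibnizSign_single_zero {n : ℕ} (k : Fin n) : leibnizSign (single k) 0 = 1 := by
  rw [leibnizSign_eq_prod (k := k) (by simp) fun i hi => by simp [hi]]
  refine Finset.prod_eq_one fun j _ => ?_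
  split_ifs with hj
  · simp [hj.ne]
  · rfl

/-- The word with the entries `1` at the places `k` and `l`. -/
abbrev pair {n : ℕ} (k l : Fin n) : Fin n → Fin 2 := single k ⊔ single l

theorem pair_left {n : ℕ} (k l : Fin n) : pair k l k = 1 :=
  (Fin.le_last _).antisymm <|
    (Pi.single_eq_same k _).ge.trans ((le_sup_left : single k ≤ pair k l) k)

theorem pair_right {n : ℕ} (k l : Fin n) : pair k l l = 1 :=
  (Fin.le_last _).antisymm <|
    (Pi.single_eq_same l _).ge.trans ((le_sup_right : single l ≤ pair k l) l)

theorem pair_of_ne {n : ℕ} {j k l : Fin n} (hk : j ≠ k) (hl : j ≠ l) : pair k l j = 0 := by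
  simp [pair, hk, hl]

theorem sum_pair {n : ℕ} {k l : Fin n} (h : k ≠ l) : ∑ i, (pair k l i : ℕ) = 1 + 1 := by
  rw [Fintype.sum_eq_add k l h fun j hj => by simp [pair_of_ne hj.1 hj.2], pair_left, pair_right]
  rfl

theorem leibnizSign_pair_single_right {n : ℕ} {k l : Fin n} (h : k < l) :
    leibnizSign (pair k l) (single l) = 1 := by
  rw [leibnizSign_eq_prod (k := k) (by simp [h.ne]) fun i hi => by simp [hi]]
  refine Finset.prod_eq_one fun j _ => ?_
  split_ifs with hj
  · simp [hj.ne, (hj.trans h).ne]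
  · rfl

theorem leibnizSign_pair_single_left {n : ℕ} {k l : Fin n} (h : k < l) :
    leibnizSign (pair k l) (single k) = -1 := by
  rw [leibnizSign_eq_prod (k := l) (by simp [h.ne']) fun i hi => by simp [hi],
    Fintype.prod_eq_single k fun j hj => ?_]
  · rw [if_pos h, pair_left]
    rfl
  · split_ifs with hl
    · simp [hj, hl.ne]
    · rfl

theorem koszulSign_eq_one {n m : ℕ} (e : Fin n ≃ Fin m) {w : Fin n → Fin 2}
    (h : ∑ i, (w i : ℕ) ≤ 1) : koszulSign e w = 1 := by
  refine Finset.prod_eq_one fun i _ => Finset.prod_eq_one fun j _ => ?_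
  split_ifs with hij
  · have sum_le := Finset.sum_le_univ_sum_of_nonneg (s := {i, j}) (f := fun i => (w i : ℕ))
      (fun _ => Nat.zero_le _)
    rw [Finset.sum_pair hij.1.ne] at sum_le
    have mul_zero : (w i : ℕ) * w j = 0 := Nat.mul_eq_zero.2 (by omega)
    rw [mul_zero, pow_zero]
  · rfl

end Signs

section ComplexPowers

variable {A : Type u} [Category.{v} A] [Abelian A] [MonoidalCategory A]

/-- The inclusion of a summand of the degree `k` part of the tensor power. -/
def cpowι (X B : A) {n k : ℕ} (w : Words n k) : word X B w.1 ⟶ cpow X B n k :=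
  biproduct.ι (fun w : Words n k => word X B w.1) w

/-- The projection on a summand of the degree `k` part of the tensor power. -/
def cpowπ (X B : A) {n k : ℕ} (w : Words n k) : cpow X B n k ⟶ word X B w.1 :=
  biproduct.π (fun w : Words n k => word X B w.1) w

theorem cpow_hom_ext {X B Z : A} {n k : ℕ} {f g : Z ⟶ cpow X B n k}
    (h : ∀ w, f ≫ cpowπ X B w = g ≫ cpowπ X B w) : f = g :=
  biproduct.hom_ext _ _ h

theorem cpow_lift_π {X B Z : A} {n k : ℕ} (f : ∀ w : Words n k, Z ⟶ word X B w.1) (w : Words n k) :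
    (biproduct.lift f : Z ⟶ cpow X B n k) ≫ cpowπ X B w = f w :=
  biproduct.lift_π _ _

theorem cpowPrj_π (X B : A) {n k : ℕ} (w : Words n k) :
    cpowPrj X B n k ≫ cpowπ X B w = wordPrj X B w.1 :=
  cpow_lift_π _ _

theorem cpowι_π_self (X B : A) {n k : ℕ} (w : Words n k) :
    cpowι X B w ≫ cpowπ X B w = 𝟙 _ :=
  biproduct.ι_π_self _ w

theorem cpowι_π_of_ne (X B : A) {n k : ℕ} {w w' : Words n k} (h : w ≠ w') :
    cpowι X B w ≫ cpowπ X B w' = 0 :=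
  biproduct.ι_π_ne _ h

variable {V₁ V₀ : A}

theorem cpowι_cpowD (d : V₁ ⟶ V₀) (n k : ℕ) (w : Words n (k + 1)) :
    cpowι V₁ V₀ w ≫ cpowD d n k =
      ∑ w' : Words n k, leibnizSign w.1 w'.1 • (wordStep d w.1 w'.1 ≫ cpowι V₁ V₀ w') := by
  have cpowι_cpowD_eq_lift : cpowι V₁ V₀ w ≫ cpowD d n k = biproduct.lift
      fun w' : Words n k => leibnizSign w.1 w'.1 • wordStep d w.1 w'.1 :=
    biproduct.ι_matrix _ _
  rw [cpowι_cpowD_eq_lift, biproduct.lift_eq]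
  exact Finset.sum_congr rfl fun w' _ => Preadditive.zsmul_comp _ _ _

theorem cpowι_cpowPerm_π [SymmetricCategory A] {n m : ℕ} (e : Fin n ≃ Fin m) {k : ℕ}
    (w : Words n k) (w' : Words m k) : cpowι V₁ V₀ w ≫ cpowPerm V₁ V₀ e k ≫ cpowπ V₁ V₀ w' =
      koszulSign e w.1 • (wordInc V₁ V₀ w.1 ≫ tperm (V₁ ⊞ V₀) e ≫ wordPrj V₁ V₀ w'.1) :=
  (congrArg (cpowι V₁ V₀ w ≫ ·) (biproduct.matrix_π _ _)).trans (biproduct.ι_desc _ _)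

theorem cpowι_single_cpowD (d : V₁ ⟶ V₀) {n : ℕ} (k : Fin n) :
    cpowι V₁ V₀ ⟨single k, sum_single k⟩ ≫ cpowD d n 0 =
      wordStep d (single k) 0 ≫ cpowι V₁ V₀ (k := 0) ⟨0, by simp⟩ := by
  rw [cpowι_cpowD, Fintype.sum_eq_single ⟨0, by simp⟩ fun w hw =>
    absurd (Subtype.ext (eq_zero_of_sum_eq_zero w.2)) hw, leibnizSign_single_zero, one_zsmul]

variable [MonoidalPreadditive A]

theorem cpowι_pair_cpowD (d : V₁ ⟶ V₀) {n : ℕ} {k l : Fin n} (h : k < l) :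
    cpowι V₁ V₀ ⟨pair k l, sum_pair h.ne⟩ ≫ cpowD d n 1 =
      wordStep d (pair k l) (single l) ≫ cpowι V₁ V₀ ⟨single l, sum_single l⟩ -
        wordStep d (pair k l) (single k) ≫ cpowι V₁ V₀ ⟨single k, sum_single k⟩ := by
  have single_ne : (⟨single l, sum_single l⟩ : Words n 1) ≠ ⟨single k, sum_single k⟩ := by
    intro hlk
    simpa [h.ne'] using congrFun (congrArg Subtype.val hlk) l
  rw [cpowι_cpowD, Fintype.sum_eq_add _ _ single_ne]
  · rw [leibnizSign_pair_single_right h, leibnizSign_pair_single_left h, one_zsmul,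
      neg_one_zsmul, sub_eq_add_neg]
  · rintro ⟨w, hw⟩ ⟨hl, hk⟩
    obtain ⟨i, rfl⟩ := exists_eq_single hw
    have hi : pair k l i = 0 :=
      pair_of_ne (by rintro rfl; exact hk rfl) (by rintro rfl; exact hl rfl)
    rw [wordStep_eq_zero d i hi (Pi.single_eq_same _ _), zero_comp, smul_zero]

theorem wordInc_cpowPrj (X B : A) {n k : ℕ} (w : Words n k) :
    wordInc X B w.1 ≫ cpowPrj X B n k = cpowι X B w := by
  refine cpow_hom_ext fun w' => ?_
  rw [Category.assoc, cpowPrj_π]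
  by_cases h : w = w'
  · subst h
    rw [wordInc_wordPrj_self, cpowι_π_self]
  · rw [wordInc_wordPrj_of_ne (Subtype.coe_injective.ne h), cpowι_π_of_ne _ _ h]

theorem wordInc_cpowPrj_of_ne (X B : A) {n k : ℕ} {w : Fin n → Fin 2}
    (h : ∑ i, (w i : ℕ) ≠ k) : wordInc X B w ≫ cpowPrj X B n k = 0 := by
  refine cpow_hom_ext fun w' => ?_
  rw [Category.assoc, cpowPrj_π, zero_comp]
  exact wordInc_wordPrj_of_ne fun hw => h (by rw [hw, w'.2])

theorem cpowPrj_cpowPerm [SymmetricCategory A] (V₁ V₀ : A) {n m : ℕ} (e : Fin n ≃ Fin m) {k : ℕ}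
    (hk : k ≤ 1) :
    cpowPrj V₁ V₀ n k ≫ cpowPerm V₁ V₀ e k = tperm (V₁ ⊞ V₀) e ≫ cpowPrj V₁ V₀ m k := by
  refine cpow_hom_ext fun w' => word_hom_ext fun w => ?_
  simp only [Category.assoc, cpowPrj_π]
  by_cases hw : ∑ i, (w i : ℕ) = k
  · rw [reassoc_of% wordInc_cpowPrj V₁ V₀ ⟨w, hw⟩, cpowι_cpowPerm_π,
      koszulSign_eq_one e (hw.trans_le hk), one_zsmul]
  · rw [reassoc_of% wordInc_cpowPrj_of_ne V₁ V₀ hw, zero_comp, wordInc_tperm_wordPrj_of_ne]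
    rintro rfl
    exact hw ((e.sum_comp fun i => (w'.1 i : ℕ)).trans w'.2)

theorem fold_cpowPrj_one (d : V₁ ⟶ V₀) (n : ℕ) :
    fold d n ≫ cpowPrj V₁ V₀ n 1 = partialMap d n ≫ biprod.fst := by
  have partialMap_fst : partialMap d n ≫ biprod.fst = _ := biprod.lift_fst _ _
  refine cpow_hom_ext fun w => ?_
  rw [Category.assoc, cpowPrj_π, fold_wordPrj, partialMap_fst]
  symm
  exact cpow_lift_π _ w

theorem fold_cpowPrj_zero (d : V₁ ⟶ V₀) (n : ℕ) :
    fold d n ≫ cpowPrj V₁ V₀ n 0 = partialMap d n ≫ biprod.snd := by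
  have partialMap_snd : partialMap d n ≫ biprod.snd = _ := biprod.lift_snd _ _
  refine cpow_hom_ext fun w => ?_
  rw [Category.assoc, cpowPrj_π, fold_wordPrj, partialMap_snd]
  symm
  exact cpow_lift_π _ w

end ComplexPowers

namespace ComplexAlg

variable {A : Type u} [Category.{v} A] [Abelian A] [MonoidalCategory A] [SymmetricCategory A]
  {P : Operad A} {V₁ V₀ : A} {d : V₁ ⟶ V₀} (S : ComplexAlg P d)

section Total

/-- The structure map of the complex as a map on the total object, zero on the words with at least
two letters `V₁`. -/
def total (n : ℕ) : P.obj n ⊗ tpow (V₁ ⊞ V₀) n ⟶ V₁ ⊞ V₀ :=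
  totalMap (S.μ₁ n) (S.μ₀ n)

/-- The structure map on the words whose only letter `V₁` is at the place `k`. -/
def linear {n : ℕ} (k : Fin n) : P.obj n ⊗ word V₁ V₀ (single k) ⟶ V₁ :=
  (P.obj n ◁ cpowι V₁ V₀ ⟨single k, sum_single k⟩) ≫ S.μ₁ n

/-- The structure map on the words without letter `V₁`. -/
def constant (n : ℕ) : P.obj n ⊗ word V₁ V₀ (0 : Fin n → Fin 2) ⟶ V₀ :=
  (P.obj n ◁ cpowι V₁ V₀ ⟨0, by simp⟩) ≫ S.μ₀ n

theorem total_fst (n : ℕ) :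
    S.total n ≫ biprod.fst = (P.obj n ◁ cpowPrj V₁ V₀ n 1) ≫ S.μ₁ n :=
  biprod.lift_fst _ _

theorem total_snd (n : ℕ) :
    S.total n ≫ biprod.snd = (P.obj n ◁ cpowPrj V₁ V₀ n 0) ≫ S.μ₀ n :=
  biprod.lift_snd _ _

theorem linear_comp {n : ℕ} (k : Fin n) :
    S.linear k ≫ d = (P.obj n ◁ wordStep d (single k) 0) ≫ S.constant n := by
  rw [linear, constant, Category.assoc, ← S.chain₁, ← whiskerLeft_comp_assoc,
    ← whiskerLeft_comp_assoc, cpowι_single_cpowD]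

variable [MonoidalPreadditive A]

theorem wordInc_total {n : ℕ} (k : Fin n) :
    (P.obj n ◁ wordInc V₁ V₀ (single k)) ≫ S.total n = S.linear k ≫ biprod.inl := by
  apply biprod.hom_ext
  · rw [Category.assoc, total_fst, ← whiskerLeft_comp_assoc,
      wordInc_cpowPrj V₁ V₀ ⟨single k, sum_single k⟩, Category.assoc, biprod.inl_fst,
      Category.comp_id, linear]
  · rw [Category.assoc, total_snd, ← whiskerLeft_comp_assoc,
      wordInc_cpowPrj_of_ne V₁ V₀ (by simp [sum_single]), MonoidalPreadditive.whiskerLeft_zero,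
      zero_comp, Category.assoc, biprod.inl_snd, comp_zero]

theorem wordInc_zero_total (n : ℕ) :
    (P.obj n ◁ wordInc V₁ V₀ 0) ≫ S.total n = S.constant n ≫ biprod.inr := by
  apply biprod.hom_ext
  · rw [Category.assoc, total_fst, ← whiskerLeft_comp_assoc,
      wordInc_cpowPrj_of_ne V₁ V₀ (by simp), MonoidalPreadditive.whiskerLeft_zero, zero_comp,
      Category.assoc, biprod.inr_fst, comp_zero]
  · rw [Category.assoc, total_snd, ← whiskerLeft_comp_assoc,
      wordInc_cpowPrj V₁ V₀ ⟨0, by simp⟩, Category.assoc, biprod.inr_snd, Category.comp_id,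
      constant]

theorem pair_linear {n : ℕ} {k l : Fin n} (h : k < l) :
    (P.obj n ◁ wordStep d (pair k l) (single l)) ≫ S.linear l =
      (P.obj n ◁ wordStep d (pair k l) (single k)) ≫ S.linear k := by
  have cycle := (P.obj n ◁ cpowι V₁ V₀ ⟨pair k l, sum_pair h.ne⟩) ≫= S.chain₂ n
  rw [comp_zero, ← whiskerLeft_comp_assoc, cpowι_pair_cpowD d h, whiskerLeft_sub,
    Preadditive.sub_comp, sub_eq_zero] at cycle
  simpa only [linear, MonoidalCategory.whiskerLeft_comp, Category.assoc] using cycle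

theorem wordStep_linear {n : ℕ} {w : Fin n → Fin 2} {k l : Fin n} (hk : w k = 1)
    (hl : w l = 1) :
    (P.obj n ◁ wordStep d w (single k)) ≫ S.linear k =
      (P.obj n ◁ wordStep d w (single l)) ≫ S.linear l := by
  wlog h : k ≤ l
  · exact (this S hl hk (le_of_not_ge h)).symm
  obtain rfl | h := h.eq_or_lt
  · rfl
  have pair_le : pair k l ≤ w := sup_le (single_le hk) (single_le hl)
  rw [← wordStep_comp d pair_le le_sup_left, ← wordStep_comp d pair_le le_sup_right]
  simp only [MonoidalCategory.whiskerLeft_comp, Category.assoc, S.pair_linear h]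

theorem total_equivariant {n m : ℕ} (e : Fin n ≃ Fin m) :
    (P.act e ▷ tpow (V₁ ⊞ V₀) n) ≫ S.total n = (P.obj m ◁ tperm (V₁ ⊞ V₀) e) ≫ S.total m := by
  apply biprod.hom_ext
  · rw [Category.assoc, Category.assoc, total_fst, total_fst, ← whisker_exchange_assoc,
      S.equivariant₁, ← whiskerLeft_comp_assoc, ← whiskerLeft_comp_assoc,
      cpowPrj_cpowPerm V₁ V₀ e le_rfl]
  · rw [Category.assoc, Category.assoc, total_snd, total_snd, ← whisker_exchange_assoc,
      S.equivariant₀, ← whiskerLeft_comp_assoc, ← whiskerLeft_comp_assoc,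
      cpowPrj_cpowPerm V₁ V₀ e zero_le_one]

end Total

section Operations

/-- The operations on the total object: `d` is applied to all arguments in `V₁` but the leftmost
one before the structure map of the complex. -/
def op (n : ℕ) : P.obj n ⊗ tpow (V₁ ⊞ V₀) n ⟶ V₁ ⊞ V₀ :=
  (P.obj n ◁ fold d n) ≫ S.total n

variable [MonoidalPreadditive A]

theorem wordInc_zero_op (n : ℕ) :
    (P.obj n ◁ wordInc V₁ V₀ 0) ≫ S.op n = S.constant n ≫ biprod.inr := by
  rw [op, ← whiskerLeft_comp_assoc, wordInc_zero_fold, wordInc_zero_total]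

-- By `wordStep_linear` any letter `V₁` may be kept in place of the leftmost one.
theorem wordInc_op {n : ℕ} {w : Fin n → Fin 2} {k : Fin n} (hk : w k = 1) :
    (P.obj n ◁ wordInc V₁ V₀ w) ≫ S.op n =
      (P.obj n ◁ wordStep d w (single k)) ≫ S.linear k ≫ biprod.inl := by
  obtain rfl | ⟨l, hl, h⟩ := eq_zero_or_exists_leading w
  · exact absurd hk.symm one_ne_zero
  rw [op, ← whiskerLeft_comp_assoc, wordInc_fold_of_leading d hl h,
    MonoidalCategory.whiskerLeft_comp_assoc, wordInc_total,
    reassoc_of% S.wordStep_linear hl hk]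

theorem op_target (n : ℕ) :
    S.op n ≫ target d = (P.obj n ◁ tpowMap (target d) n) ≫ S.total n := by
  refine whiskerLeft_word_hom_ext fun w => ?_
  have zero_le_single (k : Fin n) : 0 ≤ single k := fun _ => Fin.zero_le _
  rw [← whiskerLeft_comp_assoc, wordInc_tpowMap_target, MonoidalCategory.whiskerLeft_comp_assoc,
    wordInc_zero_total]
  obtain rfl | ⟨k, hk, -⟩ := eq_zero_or_exists_leading w
  · rw [reassoc_of% S.wordInc_zero_op n, biprod.inr_desc_assoc, Category.id_comp, wordStep_self,
      MonoidalCategory.whiskerLeft_id, Category.id_comp]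
  · rw [reassoc_of% S.wordInc_op hk, biprod.inl_desc_assoc, reassoc_of% S.linear_comp k,
      ← whiskerLeft_comp_assoc, wordStep_comp d (single_le hk) (zero_le_single k)]

theorem op_baseProj (n : ℕ) :
    S.op n ≫ baseProj V₁ V₀ = (P.obj n ◁ tpowMap (baseProj V₁ V₀) n) ≫ S.total n := by
  refine whiskerLeft_word_hom_ext fun w => ?_
  rw [← whiskerLeft_comp_assoc (P.obj n) (wordInc V₁ V₀ w) (tpowMap _ n)]
  obtain rfl | ⟨k, hk, -⟩ := eq_zero_or_exists_leading w
  · rw [wordInc_zero_tpowMap_baseProj, wordInc_zero_total, reassoc_of% S.wordInc_zero_op n,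
      biprod.inr_snd_assoc]
  · rw [wordInc_tpowMap_baseProj_eq_zero hk, reassoc_of% S.wordInc_op hk, biprod.inl_snd_assoc,
      zero_comp, comp_zero, comp_zero, MonoidalPreadditive.whiskerLeft_zero, zero_comp]

theorem op_topProj (n : ℕ) : S.op n ≫ topProj V₁ V₀ =
    (P.obj n ◁ twistedDer (baseProj V₁ V₀) (topProj V₁ V₀) (target d) n) ≫ S.total n := by
  have der_eq_sub : twistedDer (baseProj V₁ V₀) (topProj V₁ V₀) (target d) n =
      fold d n - tpowMap (baseProj V₁ V₀) n := (add_sub_cancel_right _ _).symm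
  have topProj_eq_sub : topProj V₁ V₀ = 𝟙 _ - baseProj V₁ V₀ :=
    eq_sub_of_add_eq biprod.total
  rw [der_eq_sub, topProj_eq_sub, whiskerLeft_sub, Preadditive.sub_comp, Preadditive.comp_sub,
    Category.comp_id, op_baseProj, op]

theorem op_unit : UnitLaw P S.op := by
  have unit : (P.one ▷ tpow (V₁ ⊞ V₀) 1) ≫ S.total 1 = _ := S.unit
  rw [UnitLaw, op, fold_one, MonoidalCategory.whiskerLeft_id, Category.id_comp, unit]

theorem op_comp : CompLaw P S.op := by
  intro p m q
  have comp : (P.circ p m q ▷ tpow (V₁ ⊞ V₀) (p + m + q)) ≫ S.total (p + m + q) =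
      (α_ (P.obj (p + 1 + q)) (P.obj m) (tpow (V₁ ⊞ V₀) (p + m + q))).hom ≫
        (P.obj (p + 1 + q) ◁ insertOp (S.total m) p q) ≫ S.total (p + 1 + q) := S.comp p m q
  have insertOp_fold : insertOp (S.op m) p q ≫ fold d (p + 1 + q) =
      (P.obj m ◁ fold d (p + m + q)) ≫ insertOp (S.total m) p q :=
    insertOp_twistedFold (S.op_target m) (S.op_topProj m) (S.op_baseProj m) p q
  calc
    _ = (α_ _ _ _).hom ≫ (P.obj (p + 1 + q) ◁ ((P.obj m ◁ fold d (p + m + q)) ≫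
        insertOp (S.total m) p q)) ≫ S.total (p + 1 + q) := by
      rw [op, ← whisker_exchange_assoc, comp, associator_naturality_right_assoc,
        ← whiskerLeft_comp_assoc]
    _ = _ := by
      rw [← insertOp_fold, MonoidalCategory.whiskerLeft_comp_assoc]
      rfl

theorem tpowMap_baseProj_op (n : ℕ) : (P.obj n ◁ tpowMap (baseProj V₁ V₀) n) ≫ S.op n =
    (P.obj n ◁ tpowMap (baseProj V₁ V₀) n) ≫ S.total n := by
  refine whiskerLeft_word_hom_ext fun w => ?_
  simp only [← whiskerLeft_comp_assoc]
  obtain rfl | ⟨k, hk, -⟩ := eq_zero_or_exists_leading w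
  · rw [wordInc_zero_tpowMap_baseProj, wordInc_zero_op, wordInc_zero_total]
  · rw [wordInc_tpowMap_baseProj_eq_zero hk, MonoidalPreadditive.whiskerLeft_zero, zero_comp,
      zero_comp]

theorem topProjAt_op {n : ℕ} (k : Fin n) : (P.obj n ◁ topProjAt (𝟙 _) k) ≫ S.op n =
    (P.obj n ◁ topProjAt (target d) k) ≫ S.total n := by
  refine whiskerLeft_word_hom_ext fun w => ?_
  simp only [← whiskerLeft_comp_assoc]
  obtain hk | hk : w k = 0 ∨ w k = 1 := by omega
  · rw [wordInc_topProjAt_eq_zero _ hk, wordInc_topProjAt_eq_zero _ hk,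
      MonoidalPreadditive.whiskerLeft_zero, zero_comp, zero_comp]
  · rw [wordInc_topProjAt_id hk, wordInc_topProjAt_target d hk, S.wordInc_op hk,
      MonoidalCategory.whiskerLeft_comp_assoc, wordInc_total]

theorem op_equivariant {n m : ℕ} (e : Fin n ≃ Fin m) :
    (P.act e ▷ tpow (V₁ ⊞ V₀) n) ≫ S.op n = (P.obj m ◁ tperm (V₁ ⊞ V₀) e) ≫ S.op m := by
  have equivariant_of {fₙ gₙ : tpow (V₁ ⊞ V₀) n ⟶ tpow (V₁ ⊞ V₀) n}
      {fₘ gₘ : tpow (V₁ ⊞ V₀) m ⟶ tpow (V₁ ⊞ V₀) m}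
      (hf : fₙ ≫ tperm _ e = tperm _ e ≫ fₘ) (hg : gₙ ≫ tperm _ e = tperm _ e ≫ gₘ)
      (hn : (P.obj n ◁ fₙ) ≫ S.op n = (P.obj n ◁ gₙ) ≫ S.total n)
      (hm : (P.obj m ◁ fₘ) ≫ S.op m = (P.obj m ◁ gₘ) ≫ S.total m) :
      (P.obj m ◁ fₙ) ≫ (P.act e ▷ tpow (V₁ ⊞ V₀) n) ≫ S.op n =
        (P.obj m ◁ fₙ) ≫ (P.obj m ◁ tperm (V₁ ⊞ V₀) e) ≫ S.op m := by
    rw [whisker_exchange_assoc, hn, ← whisker_exchange_assoc, S.total_equivariant,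
      ← whiskerLeft_comp_assoc, hg, ← whiskerLeft_comp_assoc, hf,
      MonoidalCategory.whiskerLeft_comp_assoc, MonoidalCategory.whiskerLeft_comp_assoc, hm]
  refine hom_ext_of_topProjAt (equivariant_of (tpowMap_tperm _ e) (tpowMap_tperm _ e)
    (S.tpowMap_baseProj_op n) (S.tpowMap_baseProj_op m)) fun k => ?_
  obtain ⟨k, rfl⟩ := e.symm.surjective k
  exact equivariant_of (topProjAt_tperm _ e k) (topProjAt_tperm _ e k) (S.topProjAt_op _)
    (S.topProjAt_op k)

end Operations

variable {A : Type u} [Category.{v} A] [Abelian A] [MonoidalCategory A] [MonoidalPreadditive A]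
  [SymmetricCategory A] {P : Operad A} {V₁ V₀ : A} {d : V₁ ⟶ V₀} (S : ComplexAlg P d)

/-- The algebra on the total object of a complex with an algebra structure. -/
def totalAlg : Alg P (V₁ ⊞ V₀) :=
  ⟨S.op, S.op_unit, S.op_comp, S.op_equivariant⟩

theorem inr_total (n : ℕ) :
    (P.obj n ◁ tpowMap biprod.inr n) ≫ S.total n = S.base n ≫ biprod.inr :=
  S.wordInc_zero_total n

theorem inr_op (n : ℕ) :
    (P.obj n ◁ tpowMap biprod.inr n) ≫ S.op n = S.base n ≫ biprod.inr :=
  S.wordInc_zero_op n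

/-- The algebra on the degree zero part of a complex with an algebra structure. -/
def baseAlg : Alg P V₀ :=
  S.totalAlg.restrict biprod.inr S.base S.inr_op

theorem isAlgHom_of_op_comp_inr {f : V₁ ⊞ V₀ ⟶ V₀}
    (hf : ∀ n, S.op n ≫ f ≫ biprod.inr =
      (P.obj n ◁ tpowMap (f ≫ biprod.inr) n) ≫ S.total n) :
    IsAlgHom S.totalAlg S.baseAlg f := by
  intro n
  have factor : (P.obj n ◁ tpowMap f n) ≫ S.base n ≫ biprod.inr =
      (P.obj n ◁ tpowMap (f ≫ biprod.inr) n) ≫ S.total n := by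
    rw [← inr_total, ← whiskerLeft_comp_assoc, tpowMap_comp]
  rw [← cancel_mono (biprod.inr : V₀ ⟶ V₁ ⊞ V₀), Category.assoc, Category.assoc]
  exact factor.trans (hf n).symm

theorem isReflexiveGraph :
    IsReflexiveGraph S.totalAlg S.baseAlg biprod.snd (biprod.desc d (𝟙 V₀)) biprod.inr where
  hom_s := S.isAlgHom_of_op_comp_inr S.op_baseProj
  hom_t := S.isAlgHom_of_op_comp_inr S.op_target
  hom_i := S.inr_op
  i_s := biprod.inr_snd
  i_t := biprod.inr_desc _ _

theorem isCat1 :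
    IsCat1 S.totalAlg S.baseAlg biprod.snd (biprod.desc d (𝟙 V₀)) biprod.inr where
  toIsReflexiveGraph := S.isReflexiveGraph
  cat1 n := by
    have fold_zero : tmap (kerInc biprod.snd (biprod.desc d (𝟙 V₀)) n) ≫ fold d (n + 2) = 0 :=
      tmap_fold_eq_zero d _ (kernel.condition _) (kernel.condition _)
    change _ ≫ S.op (n + 2) = 0
    rw [op, ← whiskerLeft_comp_assoc, fold_zero, MonoidalPreadditive.whiskerLeft_zero, zero_comp]

theorem op_eq_partialMap (n : ℕ) : S.op n = (P.obj n ◁ partialMap d n) ≫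
    ((P.obj n ◁ biprod.fst) ≫ S.μ₁ n ≫ biprod.inl +
      (P.obj n ◁ biprod.snd) ≫ S.μ₀ n ≫ biprod.inr) := by
  rw [Preadditive.comp_add, ← whiskerLeft_comp_assoc, ← whiskerLeft_comp_assoc,
    ← fold_cpowPrj_one, ← fold_cpowPrj_zero]
  apply biprod.hom_ext
  · rw [op, Category.assoc, total_fst]
    simp
  · rw [op, Category.assoc, total_snd]
    simp

theorem toEnd_totalAlg [MonoidalClosed A] (n : ℕ) :
    S.totalAlg.toEnd n = S.toEndA n ≫ rtimes d n := by
  have toEndA_ev : S.toEndA n ≫ EndA.ev d n =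
      biprod.lift (MonoidalClosed.curry ((β_ (cpow V₁ V₀ n 1) (P.obj n)).hom ≫ S.μ₁ n))
        (MonoidalClosed.curry ((β_ (cpow V₁ V₀ n 0) (P.obj n)).hom ≫ S.μ₀ n)) :=
    kernel.lift_ι _ _ _
  have toEnd_eq_curry : S.totalAlg.toEnd n =
      MonoidalClosed.curry ((β_ (tpow (V₁ ⊞ V₀) n) (P.obj n)).hom ≫ S.op n) := rfl
  rw [rtimes, reassoc_of% toEndA_ev, diagHom, biprod.lift_desc_assoc,
    MonoidalClosed.curry_pre_app_assoc, MonoidalClosed.curry_pre_app_assoc,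
    ← MonoidalClosed.curry_natural_right, ← MonoidalClosed.curry_natural_right, ← curry_add,
    MonoidalClosed.curry_pre_app, toEnd_eq_curry, op_eq_partialMap]
  simp only [Preadditive.comp_add, Category.assoc, BraidedCategory.braiding_naturality_left_assoc]

end ComplexAlg

end OpAlg

end

theorem mainTheorem8_general {A : Type u} [Category.{v} A] [Abelian A] [HasColimits A]
    [MonoidalCategory A] [SymmetricCategory A] [MonoidalClosed A]
    (P : OpAlg.Operad A) (hP : IsZero (P.obj 0)) {V₁ V₀ : A} (d : V₁ ⟶ V₀)
    (S : OpAlg.ComplexAlg P d) :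
    ∃ (a : OpAlg.Alg P (V₁ ⊞ V₀)) (b : OpAlg.Alg P V₀),
      (∀ n, a.toEnd n = S.toEndA n ≫ OpAlg.rtimes d n) ∧
      (∀ n, b.μ n = S.base n) ∧
      OpAlg.IsCat1 a b biprod.snd (biprod.desc d (𝟙 V₀)) biprod.inr ∧
      ∃ (x : OpAlg.Alg P V₁) (r : OpAlg.Action x b),
        OpAlg.IsAlgHom x a biprod.inl ∧
        r.IsInducedBy a biprod.inl biprod.inr ∧
        OpAlg.IsCrossedModule r d := by
  have := OpAlg.monoidalPreadditive_of_closed A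
  have graph := S.isCat1.toIsReflexiveGraph
  exact ⟨S.totalAlg, S.baseAlg, S.toEnd_totalAlg, fun _ => rfl, S.isCat1,
    OpAlg.kernelAlg S.totalAlg hP graph.hom_s,
    OpAlg.kernelAction S.totalAlg hP graph.hom_s graph.hom_i,
    OpAlg.isAlgHom_inl S.totalAlg hP graph.hom_s,
    OpAlg.kernelAction_isInducedBy S.totalAlg hP graph.hom_s graph.hom_i,
    S.isCat1.isCrossedModule hP⟩

theorem mainTheorem8 {A : Type u} [Category.{v} A] [Abelian A] [HasLimits A] [HasColimits A]
    [MonoidalCategory A] [SymmetricCategory A] [MonoidalClosed A]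
    (P : OpAlg.Operad A) (hP : P.IsReduced) {V₁ V₀ : A} (d : V₁ ⟶ V₀)
    (S : OpAlg.ComplexAlg P d) :
    ∃ (a : OpAlg.Alg P (V₁ ⊞ V₀)) (b : OpAlg.Alg P V₀),
      (∀ n, a.toEnd n = S.toEndA n ≫ OpAlg.rtimes d n) ∧
      (∀ n, b.μ n = S.base n) ∧
      OpAlg.IsCat1 a b biprod.snd (biprod.desc d (𝟙 V₀)) biprod.inr ∧
      ∃ (x : OpAlg.Alg P V₁) (r : OpAlg.Action x b),
        OpAlg.IsAlgHom x a biprod.inl ∧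
        r.IsInducedBy a biprod.inl biprod.inr ∧
        OpAlg.IsCrossedModule r d :=
  mainTheorem8_general P hP.1 d S
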